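/- **Conventions.** $\mathbb S^2=\{p\in\mathbb R^3:\langle p,p\rangle=1\}$, and $\mathbb H^2=\{p\in\mathbb R^3_1: p_1^2+p_2^2-p_3^2=-1,\ p_3>0\}$ is the hyperboloid model of the hyperbolic plane in Minkowski space; $\mathbb S^2\times\mathbb H^2$ carries the product metric, its Levi-Civita connection $\tilde\nabla$, and the product structure $F(v_1,v_2)=(v_1,-v_2)$. For an immersed surface $\Phi:\Sigma\to\mathbb S^2\times\mathbb H^2$ with the induced metric, let $\mathrm{II}(X,Y)=(\tilde\nabla_XY)^\perp$ be the second fundamental form, $H=\frac12\operatorname{tr}\mathrm{II}$ the mean curvature vector and $\nabla^\perp$ the normal connection. The surface is *PMC* if $H\neq0$ and $\nabla^\perp H=0$. Its *Hopf differential* is given, in any local conformal coordinate $z=x+iy$, with $\partial_z=\frac12(\partial_x-i\partial_y)$ and all tensors extended complex bilinearly, by $$\Theta=\big(4\langle \mathrm{II}(\partial_z,\partial_z),H\rangle+\langle F\partial_z,\partial_z\rangle\big)\,dz\otimes dz .$$ Everything is smooth, and curvatures of curves in $\mathbb S^2$ or $\mathbb H^2$ are signed geodesic curvatures with respect to a fixed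 (arbitrary) orientation. **Proposition.** Let $a,b,c\in\mathbb R$ with $b>0$, let $I\subseteq\mathbb R$ be an open interval and let $h:I\to\mathbb R$ be a smooth non-constant function. **(1)** Suppose that $a>0$ and that for all $x\in I$ $$h'(x)^2=\big(a-h(x)^2-b(1+(h(x)-c)^2)\big)\big(a-h(x)^2\big),\qquad a-h(x)^2>0 .$$ Define $\phi:I\times\mathbb R\to\mathbb S^2$ by $$\phi(x,y)=\tfrac1{\sqrt a}\Big(\sqrt{a-h(x)^2}\cos(\sqrt a\,y),\ \sqrt{a-h(x)^2}\sin(\sqrt a\,y),\ h(x)\Big),$$ and let $\psi:I\to\mathbb H^2$ be a smooth curve with $\|\psi'\|=\sqrt{b(1+(h-c)^2)}$ and curvature $\kappa_\psi=-\dfrac{b(a-h^2)}{\|\psi'\|^3}$. Then $$\Phi:I\times\mathbb R\to\mathbb S^2\times\mathbb H^2,\quad \Phi(x,y)=(\phi(x,y),\psi(x)),$$ is a PMC surface with $\|H\|^2=\frac b4$, and its Hopf differential vanishes identically if and only if $a=1+c^2$. **(2)** Suppose instead that for all $x\in I$ $$h'(x)^2=\big(a-h(x)^2+b(1+(h(x)-c)^2)\big)\big(a-h(x)^2\big),\qquad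 h(x)^2-a>0,$$ and, if $a\ge0$, that moreover $h>0$ on $I$. Define $\psi:I\times\mathbb R\to\mathbb H^2$ by $$\psi(x,y)=\begin{cases} \frac{1}{\sqrt a}\big(\sqrt{h(x)^2-a}\cos(\sqrt a\,y),\ \sqrt{h(x)^2-a}\sin(\sqrt a\,y),\ h(x)\big) & \text{if } a>0,\\[2pt] \frac1{\sqrt{-a}}\big(h(x),\ \sqrt{h(x)^2-a}\sinh(\sqrt{-a}\,y),\ \sqrt{h(x)^2-a}\cosh(\sqrt{-a}\,y)\big) & \text{if } a<0,\\[2pt] \frac1{2h(x)}\big((y^2-1)h(x)^2+1,\ 2yh(x)^2,\ (y^2+1)h(x)^2+1\big) & \text{if } a=0, \end{cases}$$ and let $\phi:I\to\mathbb S^2$ be a smooth curve with $\|\phi'\|=\sqrt{b(1+(h-c)^2)}$ and curvature $\kappa_\phi=-\dfrac{b(h^2-a)}{\|\phi'\|^3}$. Then $$\Phi:I\times\mathbb R\to\mathbb S^2\times\mathbb H^2,\quad \Phi(x,y)=(\phi(x),\psi(x,y)),$$ is a PMC surface with $\|H\|^2=\frac b4$, and its Hopf differential vanishes identically if and only if $a=1+c^2$.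 -/

import Mathlib

open Set Matrix
open scoped ContDiff

noncomputable section

namespace S2H2

/-! ### The Riemannian product of the unit sphere and the hyperbolic plane

The sphere is the unit sphere of Euclidean 3-space, the hyperbolic plane is the upper sheet of the
hyperboloid in Minkowski 3-space, and their product lies in the product of these two spaces. -/

/-- Euclidean / Minkowski 3-space, as a vector space of coordinate triples. -/
abbrev R3 : Type := Fin 3 → ℝ

/-- The ambient 6-space `ℝ³ × ℝ³₁`. -/
abbrev R6 : Type := R3 × R3

/-- The Minkowski inner product on `ℝ³₁`; the third coordinate is time-like. -/
def lor (p q : R3) : ℝ := p 0 * q 0 + p 1 * q 1 - p 2 * q 2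

/-- The unit sphere, of Gaussian curvature `1`. -/
def S2 : Set R3 := {p | p ⬝ᵥ p = 1}

/-- The hyperbolic plane of Gaussian curvature `-1`, in the hyperboloid model. -/
def H2 : Set R3 := {p | lor p p = -1 ∧ 0 < p 2}

/-- The inner product of `ℝ³ × ℝ³₁`. On vectors tangent to `S2 × H2` it is the product metric. -/
def metric (X Y : R6) : ℝ := X.1 ⬝ᵥ Y.1 + lor X.2 Y.2

/-- The product structure `(v₁, v₂) ↦ (v₁, -v₂)`. -/
def prodStr (X : R6) : R6 := (X.1, -X.2)

/-- Orthogonal projection of `ℝ³` onto the tangent plane of the sphere at `p`. -/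
def projS2 (p X : R3) : R3 := X - (X ⬝ᵥ p) • p

/-- Orthogonal projection of `ℝ³₁` onto the tangent plane of the hyperbolic plane at `p`
(note that `lor p p = -1`). -/
def projH2 (p X : R3) : R3 := X + lor X p • p

/-- Orthogonal projection of `ℝ³ × ℝ³₁` onto the tangent space of `S2 × H2` at `q`. -/
def proj (q X : R6) : R6 := (projS2 q.1 X.1, projH2 q.2 X.2)

/-! ### Regular curves in the two factors -/

/-- Rotation by a right angle in the tangent plane of the sphere at `p`. -/
def rotS2 (p X : R3) : R3 := crossProduct p X

/-- Rotation by a right angle in the tangent plane of the hyperbolic plane at `p`: the Minkowski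
cross product, characterized by `lor (rotH2 p X) Y = det (p, X, Y)`. -/
def rotH2 (p X : R3) : R3 :=
  ![(crossProduct p X) 0, (crossProduct p X) 1, -(crossProduct p X) 2]

/-- Norm of the velocity of a curve in the sphere. -/
def speedS2 (γ : ℝ → R3) (t : ℝ) : ℝ := √(deriv γ t ⬝ᵥ deriv γ t)

/-- Norm of the velocity of a curve in the hyperbolic plane. -/
def speedH2 (γ : ℝ → R3) (t : ℝ) : ℝ := √(lor (deriv γ t) (deriv γ t))

/-- Signed geodesic curvature `⟨∇_γ' γ', J γ'⟩ / ‖γ'‖³` of a curve in the sphere, where `J` is the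
rotation by a right angle for the orientation of the sphere chosen by the sign `o`. -/
def curvS2 (o : ℤˣ) (γ : ℝ → R3) (t : ℝ) : ℝ :=
  ((o : ℤ) : ℝ) * (projS2 (γ t) (deriv (deriv γ) t) ⬝ᵥ rotS2 (γ t) (deriv γ t)) / speedS2 γ t ^ 3

/-- Signed geodesic curvature `⟨∇_γ' γ', J γ'⟩ / ‖γ'‖³` of a curve in the hyperbolic plane, where
`J` is the rotation by a right angle for the orientation chosen by the sign `o`. -/
def curvH2 (o : ℤˣ) (γ : ℝ → R3) (t : ℝ) : ℝ :=
  ((o : ℤ) : ℝ) * lor (projH2 (γ t) (deriv (deriv γ) t)) (rotH2 (γ t) (deriv γ t)) /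
    speedH2 γ t ^ 3

/-! ### Immersed surfaces in `S2 × H2`

A surface is a map `Φ` on an open set `U` of the plane. Tangent vectors at `p ∈ U` are vectors of
the plane, identified with tangent vectors of `S2 × H2` through the differential of `Φ`. -/

/-- `Φ` restricts to a smooth immersion of the open set `U` into `S2 × H2`. -/
structure IsImmersion (Φ : ℝ × ℝ → R6) (U : Set (ℝ × ℝ)) : Prop where
  isOpen : IsOpen U
  mapsTo : MapsTo Φ U (S2 ×ˢ H2)
  smooth : ContDiffOn ℝ ∞ Φ U
  injective : ∀ p ∈ U, Function.Injective (fderiv ℝ Φ p)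

/-- The induced metric on the surface. -/
def induced (Φ : ℝ × ℝ → R6) (p v w : ℝ × ℝ) : ℝ := metric (fderiv ℝ Φ p v) (fderiv ℝ Φ p w)

/-- The coordinate vectors `∂ₓ, ∂_y` of the plane. -/
def coordVec : Fin 2 → ℝ × ℝ := ![(1, 0), (0, 1)]

/-- The matrix `(g_ij)` of the induced metric. -/
def gram (Φ : ℝ × ℝ → R6) (p : ℝ × ℝ) : Matrix (Fin 2) (Fin 2) ℝ :=
  Matrix.of fun i j => induced Φ p (coordVec i) (coordVec j)

/-- Covariant derivative in direction `v`, for the Levi-Civita connection of `S2 × H2`, of a vector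
field `V` along `Φ` that is tangent to `S2 × H2`: the projection of the ordinary derivative. -/
def covDeriv (Φ V : ℝ × ℝ → R6) (p v : ℝ × ℝ) : R6 := proj (Φ p) (fderiv ℝ V p v)

/-- The component normal to the surface of a vector tangent to `S2 × H2` at `Φ p`, that is,
`X - ∑ g^ij ⟨X, ∂_i Φ⟩ ∂_j Φ`. -/
def normalPart (Φ : ℝ × ℝ → R6) (p : ℝ × ℝ) (X : R6) : R6 :=
  X - ∑ i, ∑ j, ((gram Φ p)⁻¹ i j * metric X (fderiv ℝ Φ p (coordVec i))) •
    fderiv ℝ Φ p (coordVec j)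

/-- The second fundamental form: the normal component of the covariant derivative in direction `v`
of the (coordinate-constant) tangent field with value `w`. -/
def secondFund (Φ : ℝ × ℝ → R6) (p v w : ℝ × ℝ) : R6 :=
  normalPart Φ p (covDeriv Φ (fun q => fderiv ℝ Φ q w) p v)

/-- The mean curvature vector: half the trace of the second fundamental form. -/
def meanCurv (Φ : ℝ × ℝ → R6) (p : ℝ × ℝ) : R6 :=
  (1 / 2 : ℝ) • ∑ i, ∑ j, (gram Φ p)⁻¹ i j • secondFund Φ p (coordVec i) (coordVec j)

/-- The normal connection applied to a normal vector field `ξ`. -/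
def normalDeriv (Φ ξ : ℝ × ℝ → R6) (p v : ℝ × ℝ) : R6 := normalPart Φ p (covDeriv Φ ξ p v)

/-- Surfaces with parallel mean curvature: the mean curvature vector is nonzero and parallel in the
normal bundle. -/
structure IsPMC (Φ : ℝ × ℝ → R6) (U : Set (ℝ × ℝ)) : Prop where
  immersion : IsImmersion Φ U
  ne_zero : ∀ p ∈ U, meanCurv Φ p ≠ 0
  parallel : ∀ p ∈ U, ∀ v : ℝ × ℝ, normalDeriv Φ (meanCurv Φ) p v = 0

/-! ### The Hopf differential -/

/-- `σ`, defined on the open set `V` of the `(x, y)`-plane, is the inverse of a local conformal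
coordinate system `(x, y)` of the surface: the vectors `∂ₓ = σₓ` and `∂_y = σ_y` are
orthogonal and of the same positive length for the induced metric. -/
structure IsConformalCoord (Φ : ℝ × ℝ → R6) (U : Set (ℝ × ℝ)) (σ : ℝ × ℝ → ℝ × ℝ)
    (V : Set (ℝ × ℝ)) : Prop where
  isOpen : IsOpen V
  mapsTo : MapsTo σ V U
  smooth : ContDiffOn ℝ ∞ σ V
  injOn : InjOn σ V
  pos : ∀ q ∈ V, 0 < induced Φ (σ q) (fderiv ℝ σ q (1, 0)) (fderiv ℝ σ q (1, 0))
  same_length : ∀ q ∈ V, induced Φ (σ q) (fderiv ℝ σ q (1, 0)) (fderiv ℝ σ q (1, 0)) =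
    induced Φ (σ q) (fderiv ℝ σ q (0, 1)) (fderiv ℝ σ q (0, 1))
  orthogonal : ∀ q ∈ V, induced Φ (σ q) (fderiv ℝ σ q (1, 0)) (fderiv ℝ σ q (0, 1)) = 0

/-- The value at `(Z, Z)`, with `Z = (v - i w) / 2`, of the complex bilinear extension of a real
bilinear form `B`. -/
def sqDz (B : ℝ × ℝ → ℝ × ℝ → ℝ) (v w : ℝ × ℝ) : ℂ :=
  (((B v v - B w w : ℝ) : ℂ) - Complex.I * ((B v w + B w v : ℝ) : ℂ)) / 4

/-- The coefficient `4 ⟨h(∂_z, ∂_z), H⟩ + ⟨F ∂_z, ∂_z⟩` of `dz ⊗ dz` in the Hopf differential with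
respect to the coordinate `z = x + i y` whose inverse is `σ`, at the point with coordinates `q`;
here `∂_z = (∂ₓ - i ∂_y) / 2`. -/
def hopfCoeff (Φ : ℝ × ℝ → R6) (σ : ℝ × ℝ → ℝ × ℝ) (q : ℝ × ℝ) : ℂ :=
  4 * sqDz (fun v w => metric (secondFund Φ (σ q) v w) (meanCurv Φ (σ q)))
      (fderiv ℝ σ q (1, 0)) (fderiv ℝ σ q (0, 1)) +
    sqDz (fun v w => metric (prodStr (fderiv ℝ Φ (σ q) v)) (fderiv ℝ Φ (σ q) w))
      (fderiv ℝ σ q (1, 0)) (fderiv ℝ σ q (0, 1))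

/-- The Hopf differential vanishes identically: its coefficient is zero in every local conformal
coordinate. -/
def HopfVanishes (Φ : ℝ × ℝ → R6) (U : Set (ℝ × ℝ)) : Prop :=
  ∀ (σ : ℝ × ℝ → ℝ × ℝ) (V : Set (ℝ × ℝ)), IsConformalCoord Φ U σ V →
    ∀ q ∈ V, hopfCoeff Φ σ q = 0

/-! ### The special maps into the two factors -/

/-- The rotational map into the sphere built from `h`. -/
def phiMap (a : ℝ) (h : ℝ → ℝ) (p : ℝ × ℝ) : R3 :=
  (1 / √a) • ![√(a - h p.1 ^ 2) * Real.cos (√a * p.2),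
    √(a - h p.1 ^ 2) * Real.sin (√a * p.2), h p.1]

/-- The map into the hyperbolic plane built from `h`, of elliptic, hyperbolic or parabolic type
according to the sign of `a`. -/
def psiMap (a : ℝ) (h : ℝ → ℝ) (p : ℝ × ℝ) : R3 :=
  if 0 < a then
    (1 / √a) • ![√(h p.1 ^ 2 - a) * Real.cos (√a * p.2),
      √(h p.1 ^ 2 - a) * Real.sin (√a * p.2), h p.1]
  else if a < 0 then
    (1 / √(-a)) • ![h p.1, √(h p.1 ^ 2 - a) * Real.sinh (√(-a) * p.2),
      √(h p.1 ^ 2 - a) * Real.cosh (√(-a) * p.2)]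
  else
    (1 / (2 * h p.1)) • ![(p.2 ^ 2 - 1) * h p.1 ^ 2 + 1, 2 * p.2 * h p.1 ^ 2,
      (p.2 ^ 2 + 1) * h p.1 ^ 2 + 1]

end S2H2

end

open S2H2

/-!
Both families are instances of one construction. A sign `ε` tells which factor carries the
rotational map (`1` for the sphere, `-1` for the hyperbolic plane), and `L = ε (a - h ^ 2) > 0`.
The rotational map, as a function of `h` and `y`, has orthogonal partial derivatives `ξ` and `η`
with `|ξ|² = 1 / L` and `|η|² = L` (`IsRotationalMap`), whatever the type of the rotation. The curve
has velocity `T` and rotated velocity `N` of squared length `b (1 + u ^ 2)`, where `u = h - c`, and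
the assumption on its curvature turns the Frenet equations (`isFrenetCurve`) into
`∇ T = (u h' T - L N) / (1 + u ^ 2)` and `∇ N = (u h' N + L T) / (1 + u ^ 2)`.

The differential of the surface is `dx (h' ξ + T) + dy η`, and the first integral for `h` says exactly
that `x`, `y` are conformal coordinates with factor `L` (`IsAdaptedFrame.induced_eq`). A smooth
non-constant solution of the first integral also satisfies its derivative, a second order equation
(`two_mul_deriv_deriv_eq`); smoothness excludes solutions that rest at a turning point. With it the
mean curvature vector becomes
`2 H = -b u ξ + (u h' / (L (1 + u ^ 2))) T - (1 / (1 + u ^ 2)) N` (`IsAdaptedFrame.meanCurv_eq`).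
Its squared length is `b / 4`, its covariant derivative by `y` is a multiple of `η`, and that by `x`
is a multiple of `h' ξ + T`, so that it is parallel in the normal bundle.

In the coordinates `x`, `y` the bilinear form behind the Hopf differential is diagonal, and the
difference of its diagonal entries is `2 b ε (a - 1 - c ^ 2)` (`IsAdaptedFrame.hopf_form`). Conformal
coordinates see only the traceless part of the form, so this number decides whether the Hopf
differential vanishes.
-/

noncomputable section

namespace S2H2

/-! ### Covariant differentiation along a map -/

theorem lor_eq (p q : R3) : lor p q = p 0 * q 0 + p 1 * q 1 - p 2 * q 2 := rfl

theorem dot_eq (p q : R3) : p ⬝ᵥ q = p 0 * q 0 + p 1 * q 1 + p 2 * q 2 := by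
  simp [dotProduct, Fin.sum_univ_three]

theorem metric_add_left (X Y Z : R6) : metric (X + Y) Z = metric X Z + metric Y Z := by
  simp only [metric, lor_eq, dot_eq, Prod.fst_add, Prod.snd_add, Pi.add_apply]; ring

theorem metric_smul_left (r : ℝ) (X Z : R6) : metric (r • X) Z = r * metric X Z := by
  simp only [metric, lor_eq, dot_eq, Prod.smul_fst, Prod.smul_snd, Pi.smul_apply, smul_eq_mul]; ring

theorem metric_comm (X Y : R6) : metric X Y = metric Y X := by
  simp only [metric, lor_eq, dot_eq]; ring

theorem metric_add_right (X Y Z : R6) : metric Z (X + Y) = metric Z X + metric Z Y := by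
  rw [metric_comm, metric_add_left, metric_comm X, metric_comm Y]

theorem metric_smul_right (r : ℝ) (X Z : R6) : metric Z (r • X) = r * metric Z X := by
  rw [metric_comm, metric_smul_left, metric_comm X]

theorem proj_add (q X Y : R6) : proj q (X + Y) = proj q X + proj q Y := by
  ext i <;> simp [proj, projS2, projH2, lor_eq, dot_eq] <;> ring

theorem proj_smul (q : R6) (r : ℝ) (X : R6) : proj q (r • X) = r • proj q X := by
  ext i <;> simp [proj, projS2, projH2, lor_eq, dot_eq] <;> ring

/-- `V` is differentiable at `p` and tangent to `S2 × H2` there, and its covariant derivatives along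
`Φ` in the directions `∂ₓ` and `∂_y` are `A` and `B`. -/
structure HasCovDerivs (Φ V : ℝ × ℝ → R6) (p : ℝ × ℝ) (A B : R6) : Prop where
  differentiableAt : DifferentiableAt ℝ V p
  tangent : proj (Φ p) (V p) = V p
  covDeriv_eq : ∀ v : ℝ × ℝ, covDeriv Φ V p v = v.1 • A + v.2 • B

namespace HasCovDerivs

variable {Φ V W : ℝ × ℝ → R6} {p : ℝ × ℝ} {A B C D : R6}

theorem add (hV : HasCovDerivs Φ V p A B) (hW : HasCovDerivs Φ W p C D) :
    HasCovDerivs Φ (fun q => V q + W q) p (A + C) (B + D) := by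
  refine ⟨hV.1.add hW.1, by rw [proj_add, hV.2, hW.2], fun v => ?_⟩
  have hV' := hV.3 v
  have hW' := hW.3 v
  unfold covDeriv at *
  rw [fderiv_fun_add hV.1 hW.1, _root_.add_apply, proj_add, hV', hW']
  module

/-- The Leibniz rule for a coefficient that depends on `x` only. -/
theorem smul {k : ℝ → ℝ} {k' : ℝ} (hk : HasDerivAt k k' p.1) (hV : HasCovDerivs Φ V p A B) :
    HasCovDerivs Φ (fun q => k q.1 • V q) p (k' • V p + k p.1 • A) (k p.1 • B) := by
  have hk2 : HasFDerivAt (fun q : ℝ × ℝ => k q.1) _ p := hk.hasFDerivAt.comp p hasFDerivAt_fst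
  refine ⟨hk2.differentiableAt.smul hV.1, by rw [proj_smul, hV.2], fun v => ?_⟩
  have hV' := hV.3 v
  unfold covDeriv at *
  rw [fderiv_fun_smul hk2.differentiableAt hV.1, hk2.fderiv]
  simp [proj_add, proj_smul, hV', hV.2]
  module

theorem congr (hV : HasCovDerivs Φ V p A B) (hVW : W =ᶠ[nhds p] V) : HasCovDerivs Φ W p A B := by
  refine ⟨hV.1.congr_of_eventuallyEq hVW, by rw [hVW.self_of_nhds, hV.2], fun v => ?_⟩
  have := hV.3 v
  unfold covDeriv at *
  rw [hVW.fderiv_eq, this]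

end HasCovDerivs

/-! ### Surfaces with an adapted frame -/

/-- The functions and vector fields that govern both families of surfaces. The sign `ε` tells which
factor carries the rotational map (`1` for the sphere, `-1` for the hyperbolic plane); `ξ` and `η`
are the derivatives of that map by `h` and by `y`, while `T` is the velocity of the curve in the
other factor and `N` is `T` turned by a right angle. -/
structure IsAdaptedFrame (ε a b c : ℝ) (I : Set ℝ) (h : ℝ → ℝ) (Φ ξ η T N : ℝ × ℝ → R6) :
    Prop where
  sign : ε * ε = 1
  isOpen : IsOpen I
  pos : ∀ x ∈ I, 0 < ε * (a - h x ^ 2)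
  hasDerivAt : ∀ x ∈ I, HasDerivAt h (deriv h x) x
  firstIntegral : ∀ x ∈ I, deriv h x ^ 2 =
    (ε * (a - h x ^ 2)) ^ 2 - ε * (a - h x ^ 2) * (b * (1 + (h x - c) ^ 2))
  hasDerivAt_deriv : ∀ x ∈ I, HasDerivAt (deriv h)
    (-2 * ε * h x * (ε * (a - h x ^ 2)) + ε * h x * (b * (1 + (h x - c) ^ 2))
      - ε * (a - h x ^ 2) * b * (h x - c)) x
  fderiv_eq : ∀ p : ℝ × ℝ, p.1 ∈ I → ∀ v : ℝ × ℝ,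
    fderiv ℝ Φ p v = v.1 • (deriv h p.1 • ξ p + T p) + v.2 • η p
  cov_xi : ∀ p : ℝ × ℝ, p.1 ∈ I → HasCovDerivs Φ ξ p
    ((ε * h p.1 * deriv h p.1 / (ε * (a - h p.1 ^ 2))) • ξ p)
    ((-(ε * h p.1 / (ε * (a - h p.1 ^ 2)))) • η p)
  cov_eta : ∀ p : ℝ × ℝ, p.1 ∈ I → HasCovDerivs Φ η p
    ((-(ε * h p.1 * deriv h p.1 / (ε * (a - h p.1 ^ 2)))) • η p)
    ((ε * (ε * (a - h p.1 ^ 2)) * h p.1) • ξ p)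
  cov_T : ∀ p : ℝ × ℝ, p.1 ∈ I → HasCovDerivs Φ T p
    (((h p.1 - c) * deriv h p.1 / (1 + (h p.1 - c) ^ 2)) • T p
      - (ε * (a - h p.1 ^ 2) / (1 + (h p.1 - c) ^ 2)) • N p) 0
  cov_N : ∀ p : ℝ × ℝ, p.1 ∈ I → HasCovDerivs Φ N p
    (((h p.1 - c) * deriv h p.1 / (1 + (h p.1 - c) ^ 2)) • N p
      + (ε * (a - h p.1 ^ 2) / (1 + (h p.1 - c) ^ 2)) • T p) 0
  xi_xi : ∀ p : ℝ × ℝ, p.1 ∈ I → metric (ξ p) (ξ p) = 1 / (ε * (a - h p.1 ^ 2))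
  eta_eta : ∀ p : ℝ × ℝ, p.1 ∈ I → metric (η p) (η p) = ε * (a - h p.1 ^ 2)
  xi_eta : ∀ p : ℝ × ℝ, p.1 ∈ I → metric (ξ p) (η p) = 0
  T_T : ∀ p : ℝ × ℝ, p.1 ∈ I → metric (T p) (T p) = b * (1 + (h p.1 - c) ^ 2)
  N_N : ∀ p : ℝ × ℝ, p.1 ∈ I → metric (N p) (N p) = b * (1 + (h p.1 - c) ^ 2)
  T_N : ∀ p : ℝ × ℝ, p.1 ∈ I → metric (T p) (N p) = 0
  xi_T : ∀ p : ℝ × ℝ, p.1 ∈ I → metric (ξ p) (T p) = 0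
  xi_N : ∀ p : ℝ × ℝ, p.1 ∈ I → metric (ξ p) (N p) = 0
  eta_T : ∀ p : ℝ × ℝ, p.1 ∈ I → metric (η p) (T p) = 0
  eta_N : ∀ p : ℝ × ℝ, p.1 ∈ I → metric (η p) (N p) = 0
  prodStr_xi : ∀ p, prodStr (ξ p) = ε • ξ p
  prodStr_eta : ∀ p, prodStr (η p) = ε • η p
  prodStr_T : ∀ p, prodStr (T p) = -ε • T p

namespace IsAdaptedFrame

variable {ε a b c : ℝ} {I : Set ℝ} {h : ℝ → ℝ} {Φ ξ η T N : ℝ × ℝ → R6} {p : ℝ × ℝ}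

theorem eventually_mem (F : IsAdaptedFrame ε a b c I h Φ ξ η T N) (hp : p.1 ∈ I) :
    ∀ᶠ q : ℝ × ℝ in nhds p, q.1 ∈ I :=
  continuousAt_fst.eventually (F.isOpen.mem_nhds hp)

theorem one_add_sq_pos (t : ℝ) : 0 < 1 + t ^ 2 := by positivity

/-- The coordinates of an adapted frame are conformal. -/
theorem induced_eq (F : IsAdaptedFrame ε a b c I h Φ ξ η T N) (hp : p.1 ∈ I) (v w : ℝ × ℝ) :
    induced Φ p v w = ε * (a - h p.1 ^ 2) * (v.1 * w.1 + v.2 * w.2) := by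
  have hl := (F.pos _ hp).ne'
  have h1 := F.firstIntegral _ hp
  unfold induced
  rw [F.fderiv_eq p hp, F.fderiv_eq p hp]
  simp only [metric_add_left, metric_add_right, metric_smul_left, metric_smul_right,
    metric_comm (η p) (ξ p), metric_comm (T p) (ξ p), metric_comm (T p) (η p),
    F.xi_xi p hp, F.eta_eta p hp, F.xi_eta p hp, F.T_T p hp, F.xi_T p hp, F.eta_T p hp]
  have : deriv h p.1 * (deriv h p.1 * (1 / (ε * (a - h p.1 ^ 2)))) =
      ε * (a - h p.1 ^ 2) - b * (1 + (h p.1 - c) ^ 2) := by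
    rw [mul_one_div, ← mul_div_assoc, ← sq, h1]
    generalize ε * (a - h p.1 ^ 2) = L at hl ⊢
    field_simp
  linear_combination v.1 * w.1 * this

theorem gram_eq (F : IsAdaptedFrame ε a b c I h Φ ξ η T N) (hp : p.1 ∈ I) :
    gram Φ p = (ε * (a - h p.1 ^ 2)) • (1 : Matrix (Fin 2) (Fin 2) ℝ) := by
  ext i j
  simp only [gram, Matrix.of_apply, F.induced_eq hp]
  fin_cases i <;> fin_cases j <;> simp [coordVec]

theorem gram_inv (F : IsAdaptedFrame ε a b c I h Φ ξ η T N) (hp : p.1 ∈ I) :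
    (gram Φ p)⁻¹ = (ε * (a - h p.1 ^ 2))⁻¹ • (1 : Matrix (Fin 2) (Fin 2) ℝ) := by
  rw [F.gram_eq hp]
  apply Matrix.inv_eq_left_inv
  rw [Matrix.smul_mul, Matrix.mul_smul, smul_smul, inv_mul_cancel₀ (F.pos _ hp).ne', one_smul,
    one_mul]

theorem normalPart_eq (F : IsAdaptedFrame ε a b c I h Φ ξ η T N) (hp : p.1 ∈ I) (X : R6) :
    normalPart Φ p X = X
      - ((ε * (a - h p.1 ^ 2))⁻¹ * metric X (deriv h p.1 • ξ p + T p)) •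
          (deriv h p.1 • ξ p + T p)
      - ((ε * (a - h p.1 ^ 2))⁻¹ * metric X (η p)) • η p := by
  simp only [normalPart, F.gram_inv hp, F.fderiv_eq p hp]
  simp [coordVec, Fin.sum_univ_two, Matrix.smul_apply, sub_sub]

theorem normalPart_add (F : IsAdaptedFrame ε a b c I h Φ ξ η T N) (hp : p.1 ∈ I) (X Y : R6) :
    normalPart Φ p (X + Y) = normalPart Φ p X + normalPart Φ p Y := by
  simp only [F.normalPart_eq hp, metric_add_left]
  module

theorem normalPart_smul (F : IsAdaptedFrame ε a b c I h Φ ξ η T N) (hp : p.1 ∈ I) (r : ℝ)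
    (X : R6) : normalPart Φ p (r • X) = r • normalPart Φ p X := by
  simp only [F.normalPart_eq hp, metric_smul_left]
  module

theorem normalPart_eta (F : IsAdaptedFrame ε a b c I h Φ ξ η T N) (hp : p.1 ∈ I) :
    normalPart Φ p (η p) = 0 := by
  rw [F.normalPart_eq hp]
  simp only [metric_add_right, metric_smul_right, metric_comm (η p) (ξ p), F.eta_eta p hp,
    F.xi_eta p hp, F.eta_T p hp, inv_mul_cancel₀ (F.pos _ hp).ne']
  module

theorem normalPart_dx (F : IsAdaptedFrame ε a b c I h Φ ξ η T N) (hp : p.1 ∈ I) :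
    normalPart Φ p (deriv h p.1 • ξ p + T p) = 0 := by
  have h1 := F.induced_eq hp (1, 0) (1, 0)
  have h2 := F.induced_eq hp (1, 0) (0, 1)
  simp only [induced, F.fderiv_eq p hp] at h1 h2
  simp only [one_smul, zero_smul, add_zero, zero_add, mul_one, mul_zero] at h1 h2
  rw [F.normalPart_eq hp, h1, h2, inv_mul_cancel₀ (F.pos _ hp).ne']
  module

/-- The covariant derivatives of the coordinate field with constant value `w`. -/
theorem cov_fderiv (F : IsAdaptedFrame ε a b c I h Φ ξ η T N) (hp : p.1 ∈ I) (v w : ℝ × ℝ) :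
    covDeriv Φ (fun q => fderiv ℝ Φ q w) p v =
      (v.1 * w.1) • ((-2 * ε * h p.1 * (ε * (a - h p.1 ^ 2))
          + ε * h p.1 * (b * (1 + (h p.1 - c) ^ 2)) - ε * (a - h p.1 ^ 2) * b * (h p.1 - c)
          + deriv h p.1 * (ε * h p.1 * deriv h p.1 / (ε * (a - h p.1 ^ 2)))) • ξ p
        + (((h p.1 - c) * deriv h p.1 / (1 + (h p.1 - c) ^ 2)) • T p
          - (ε * (a - h p.1 ^ 2) / (1 + (h p.1 - c) ^ 2)) • N p))
      + (v.2 * w.2) • ((ε * (ε * (a - h p.1 ^ 2)) * h p.1) • ξ p)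
      + (-(v.1 * w.2 + v.2 * w.1) *
          (ε * h p.1 * deriv h p.1 / (ε * (a - h p.1 ^ 2)))) • η p := by
  have key := (((HasCovDerivs.smul (F.hasDerivAt_deriv _ hp) (F.cov_xi p hp)).add
    (F.cov_T p hp)).smul (hasDerivAt_const p.1 w.1)).add
      ((F.cov_eta p hp).smul (hasDerivAt_const p.1 w.2))
  have ev : (fun q => fderiv ℝ Φ q w) =ᶠ[nhds p]
      fun q => w.1 • (deriv h q.1 • ξ q + T q) + w.2 • η q :=
    (F.eventually_mem hp).mono fun q hq => F.fderiv_eq q hq w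
  rw [(key.congr ev).covDeriv_eq v]
  module

/-- The coefficient of `ξ` in the covariant `x`-derivative of `∂ₓ`. Added to that in the covariant
`y`-derivative of `∂_y`, it gives `-b (h - c)` times the conformal factor. -/
theorem xi_coeff_eq (F : IsAdaptedFrame ε a b c I h Φ ξ η T N) (hp : p.1 ∈ I) :
    -2 * ε * h p.1 * (ε * (a - h p.1 ^ 2)) + ε * h p.1 * (b * (1 + (h p.1 - c) ^ 2))
        - ε * (a - h p.1 ^ 2) * b * (h p.1 - c)
        + deriv h p.1 * (ε * h p.1 * deriv h p.1 / (ε * (a - h p.1 ^ 2))) =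
      -(b * (h p.1 - c)) * (ε * (a - h p.1 ^ 2)) - ε * (ε * (a - h p.1 ^ 2)) * h p.1 := by
  have hl := (F.pos _ hp).ne'
  have h1 := F.firstIntegral _ hp
  generalize ε * (a - h p.1 ^ 2) = L at hl h1 ⊢
  field_simp
  linear_combination ε * h p.1 * h1

theorem secondFund_eq (F : IsAdaptedFrame ε a b c I h Φ ξ η T N) (hp : p.1 ∈ I) (v w : ℝ × ℝ) :
    secondFund Φ p v w =
      (v.1 * w.1) • normalPart Φ p
        ((-(b * (h p.1 - c)) * (ε * (a - h p.1 ^ 2)) - ε * (ε * (a - h p.1 ^ 2)) * h p.1) • ξ p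
          + (((h p.1 - c) * deriv h p.1 / (1 + (h p.1 - c) ^ 2)) • T p
            - (ε * (a - h p.1 ^ 2) / (1 + (h p.1 - c) ^ 2)) • N p))
      + (v.2 * w.2) • normalPart Φ p ((ε * (ε * (a - h p.1 ^ 2)) * h p.1) • ξ p) := by
  unfold secondFund
  rw [F.cov_fderiv hp, F.xi_coeff_eq hp, F.normalPart_add hp, F.normalPart_add hp]
  simp only [F.normalPart_smul hp _ (η p), F.normalPart_eta hp]
  rw [F.normalPart_smul hp, F.normalPart_smul hp (v.2 * w.2), smul_zero, add_zero]

/-- The mean curvature vector in the adapted frame, with coefficients that depend on `x` alone. It is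
half the tension of the map divided by the conformal factor; the normal projection drops out, as the
tension of a conformal immersion is normal. -/
theorem meanCurv_eq (F : IsAdaptedFrame ε a b c I h Φ ξ η T N) (hp : p.1 ∈ I) :
    meanCurv Φ p = (-(b * (h p.1 - c)) / 2) • ξ p
      + (((h p.1 - c) * deriv h p.1 /
          ((1 + (h p.1 - c) ^ 2) * (ε * (a - h p.1 ^ 2))) / 2) • T p
        + (-(1 + (h p.1 - c) ^ 2)⁻¹ / 2) • N p) := by
  have hl := (F.pos _ hp).ne'
  have hw := (one_add_sq_pos (h p.1 - c)).ne'
  have e : meanCurv Φ p = (1 / 2 * (ε * (a - h p.1 ^ 2))⁻¹) • normalPart Φ p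
      ((-(b * (h p.1 - c)) * (ε * (a - h p.1 ^ 2))) • ξ p
          + (((h p.1 - c) * deriv h p.1 / (1 + (h p.1 - c) ^ 2)) • T p
            - (ε * (a - h p.1 ^ 2) / (1 + (h p.1 - c) ^ 2)) • N p)) := by
    simp only [meanCurv, F.gram_inv hp, F.secondFund_eq hp]
    simp only [coordVec, Fin.sum_univ_two, Matrix.smul_apply, Matrix.one_apply]
    simp [← F.normalPart_add hp, ← smul_add, smul_smul]
    congr 2
    module
  have e1 : metric ((-(b * (h p.1 - c)) * (ε * (a - h p.1 ^ 2))) • ξ p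
          + (((h p.1 - c) * deriv h p.1 / (1 + (h p.1 - c) ^ 2)) • T p
            + (-(ε * (a - h p.1 ^ 2) / (1 + (h p.1 - c) ^ 2))) • N p))
        (deriv h p.1 • ξ p + T p) = 0 := by
    simp only [metric_add_left, metric_add_right, metric_smul_left, metric_smul_right,
      metric_comm (N p) (ξ p), metric_comm (T p) (ξ p), metric_comm (N p) (T p),
      F.xi_xi p hp, F.T_T p hp, F.xi_T p hp, F.T_N p hp, F.xi_N p hp]
    generalize ε * (a - h p.1 ^ 2) = L at hl ⊢
    field_simp
    ring
  have e2 : metric ((-(b * (h p.1 - c)) * (ε * (a - h p.1 ^ 2))) • ξ p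
          + (((h p.1 - c) * deriv h p.1 / (1 + (h p.1 - c) ^ 2)) • T p
            + (-(ε * (a - h p.1 ^ 2) / (1 + (h p.1 - c) ^ 2))) • N p)) (η p) = 0 := by
    simp only [metric_add_left, metric_smul_left,
      metric_comm (N p) (η p), metric_comm (T p) (η p),
      F.xi_eta p hp, F.eta_T p hp, F.eta_N p hp]
    ring
  rw [e, F.normalPart_eq hp, sub_eq_add_neg (_ • T p), ← neg_smul, e1, e2]
  generalize ε * (a - h p.1 ^ 2) = L at hl ⊢
  match_scalars <;> field_simp <;> ring

theorem metric_meanCurv (F : IsAdaptedFrame ε a b c I h Φ ξ η T N) (hp : p.1 ∈ I) :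
    metric (meanCurv Φ p) (meanCurv Φ p) = b / 4 := by
  have hl := (F.pos _ hp).ne'
  have hw := (one_add_sq_pos (h p.1 - c)).ne'
  have h1 := F.firstIntegral _ hp
  rw [F.meanCurv_eq hp]
  simp only [metric_add_left, metric_add_right, metric_smul_left, metric_smul_right,
      metric_comm (N p) (ξ p), metric_comm (T p) (ξ p), metric_comm (N p) (T p),
      F.xi_xi p hp, F.T_T p hp, F.xi_T p hp, F.T_N p hp, F.xi_N p hp, F.N_N p hp]
  generalize ε * (a - h p.1 ^ 2) = L at hl h1 ⊢
  field_simp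
  linear_combination 4 * b * (h p.1 - c) ^ 2 * (1 + (h p.1 - c) ^ 2) * h1

theorem normalDeriv_meanCurv (F : IsAdaptedFrame ε a b c I h Φ ξ η T N) (hp : p.1 ∈ I)
    (v : ℝ × ℝ) : normalDeriv Φ (meanCurv Φ) p v = 0 := by
  have hl := (F.pos _ hp).ne'
  have hw := (one_add_sq_pos (h p.1 - c)).ne'
  have h1 := F.firstIntegral _ hp
  have dh := F.hasDerivAt _ hp
  have du := dh.sub_const c
  have dw := (du.fun_pow 2).const_add 1
  have dL := ((dh.fun_pow 2).const_sub a).const_mul ε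
  have k1 := (du.const_mul b).fun_neg.div_const 2
  have k2 := ((du.fun_mul (F.hasDerivAt_deriv _ hp)).fun_div (dw.fun_mul dL)
    (mul_ne_zero hw hl)).div_const 2
  have k3 := (dw.fun_inv hw).fun_neg.div_const 2
  have key := ((F.cov_xi p hp).smul k1).add (((F.cov_T p hp).smul k2).add ((F.cov_N p hp).smul k3))
  have ev := (F.eventually_mem hp).mono fun q hq => F.meanCurv_eq hq
  unfold normalDeriv
  rw [(key.congr ev).covDeriv_eq v]
  -- The derivative of the mean curvature vector is tangent to the surface.
  have e : ∀ X Y : R6, X = ((-b - b * ε * (h p.1 - c) * h p.1 / (ε * (a - h p.1 ^ 2))) / 2) •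
        (deriv h p.1 • ξ p + T p) →
      Y = ((b * (h p.1 - c)) / 2 * (ε * h p.1 / (ε * (a - h p.1 ^ 2)))) • η p →
      normalPart Φ p (v.1 • X + v.2 • Y) = 0 := by
    rintro X Y rfl rfl
    simp only [F.normalPart_add hp, F.normalPart_smul hp, normalPart_eta F hp]
    rw [← F.normalPart_smul hp, ← F.normalPart_add hp, F.normalPart_dx hp]
    simp
  apply e
  · generalize ε * (a - h p.1 ^ 2) = L at hl h1 ⊢
    match_scalars
    · field_simp
      ring
    · field_simp
      linear_combination (L + 2 * ε * (h p.1 - c) * h p.1 * (1 + (h p.1 - c) ^ 2)) * h1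
    · field_simp
      ring
  · module

theorem metric_normalPart_meanCurv (F : IsAdaptedFrame ε a b c I h Φ ξ η T N) (hp : p.1 ∈ I)
    (X : R6) : metric (normalPart Φ p X) (meanCurv Φ p) = metric X (meanCurv Φ p) := by
  have hl := (F.pos _ hp).ne'
  have hw := (one_add_sq_pos (h p.1 - c)).ne'
  have e1 : metric (deriv h p.1 • ξ p + T p) (meanCurv Φ p) = 0 := by
    rw [F.meanCurv_eq hp]
    simp only [metric_add_left, metric_add_right, metric_smul_left, metric_smul_right,
      metric_comm (T p) (ξ p), F.xi_xi p hp, F.T_T p hp, F.xi_T p hp, F.T_N p hp, F.xi_N p hp]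
    generalize ε * (a - h p.1 ^ 2) = L at hl ⊢
    field_simp
    ring
  have e2 : metric (η p) (meanCurv Φ p) = 0 := by
    rw [F.meanCurv_eq hp]
    simp only [metric_add_right, metric_smul_right, metric_comm (η p) (ξ p),
      F.xi_eta p hp, F.eta_T p hp, F.eta_N p hp]
    ring
  rw [F.normalPart_eq hp, sub_eq_add_neg, sub_eq_add_neg, ← neg_smul, ← neg_smul,
    metric_add_left, metric_add_left, metric_smul_left, metric_smul_left, e1, e2]
  ring

/-- The real form of the Hopf coefficient: the traceless part of this symmetric bilinear form, which
is diagonal in the coordinates `x`, `y`, is a multiple of `a - (1 + c ^ 2)`. -/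
theorem hopf_form (F : IsAdaptedFrame ε a b c I h Φ ξ η T N) (hp : p.1 ∈ I) :
    ∃ m : ℝ, ∀ v w : ℝ × ℝ,
      4 * metric (secondFund Φ p v w) (meanCurv Φ p) +
          metric (prodStr (fderiv ℝ Φ p v)) (fderiv ℝ Φ p w) =
        m * (v.1 * w.1 + v.2 * w.2) + 2 * b * ε * (a - (1 + c ^ 2)) * (v.1 * w.1) := by
  have hl := (F.pos _ hp).ne'
  have hw := (one_add_sq_pos (h p.1 - c)).ne'
  have h1 := F.firstIntegral _ hp
  refine ⟨-(2 * ε * b * h p.1 * (h p.1 - c)) + ε * (ε * (a - h p.1 ^ 2)), fun v w => ?_⟩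
  have eF : prodStr (fderiv ℝ Φ p v) =
      (v.1 * deriv h p.1 * ε) • ξ p + ((-ε * v.1) • T p + (v.2 * ε) • η p) := by
    have hadd : ∀ X Y, prodStr (X + Y) = prodStr X + prodStr Y := fun X Y => by
      simp [prodStr, add_comm]
    have hsmul : ∀ (r : ℝ) X, prodStr (r • X) = r • prodStr X := fun r X => by
      simp [prodStr]
    simp only [F.fderiv_eq p hp, hadd, hsmul, F.prodStr_xi, F.prodStr_eta, F.prodStr_T]
    module
  rw [eF, F.secondFund_eq hp, F.fderiv_eq p hp, metric_add_left, metric_smul_left,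
    metric_smul_left, F.metric_normalPart_meanCurv hp, F.metric_normalPart_meanCurv hp,
    F.meanCurv_eq hp, sub_eq_add_neg (_ • T p), ← neg_smul]
  simp only [metric_add_left, metric_add_right, metric_smul_left, metric_smul_right,
    metric_comm (η p) (ξ p), metric_comm (T p) (ξ p), metric_comm (T p) (η p),
    metric_comm (N p) (ξ p), metric_comm (N p) (T p),
    F.xi_xi p hp, F.eta_eta p hp, F.xi_eta p hp, F.T_T p hp, F.xi_T p hp, F.eta_T p hp,
    F.T_N p hp, F.xi_N p hp, F.N_N p hp]
  have hL : ε * (a - (1 + c ^ 2)) = ε * (a - h p.1 ^ 2) + ε * (h p.1 ^ 2 - (1 + c ^ 2)) := by ring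
  rw [mul_assoc (2 * b), hL]
  generalize ε * (a - h p.1 ^ 2) = L at hl h1 ⊢
  field_simp
  linear_combination v.1 * w.1 * (2 * ε * (1 + (h p.1 - c) ^ 2) ^ 2 +
    4 * b * (h p.1 - c) ^ 2 * (1 + (h p.1 - c) ^ 2)) * h1

theorem hopfCoeff_eq (F : IsAdaptedFrame ε a b c I h Φ ξ η T N) {σ : ℝ × ℝ → ℝ × ℝ}
    {V : Set (ℝ × ℝ)} (hσ : IsConformalCoord Φ (I ×ˢ univ) σ V) {q : ℝ × ℝ} (hq : q ∈ V) :
    hopfCoeff Φ σ q = 2 * b * ε * (a - (1 + c ^ 2)) *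
      sqDz (fun v w => v.1 * w.1) (fderiv ℝ σ q (1, 0)) (fderiv ℝ σ q (0, 1)) := by
  have hp : (σ q).1 ∈ I := (hσ.mapsTo hq).1
  have hl := (F.pos _ hp).ne'
  obtain ⟨m, hm⟩ := F.hopf_form hp
  have h1 := hσ.same_length q hq
  have h2 := hσ.orthogonal q hq
  rw [F.induced_eq hp, F.induced_eq hp] at h1
  rw [F.induced_eq hp] at h2
  have h1 := mul_left_cancel₀ hl h1
  have h2 := (mul_eq_zero.1 h2).resolve_left hl
  unfold hopfCoeff
  generalize fderiv ℝ σ q (1, 0) = v at *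
  generalize fderiv ℝ σ q (0, 1) = w at *
  have e1 := hm v v
  have e2 := hm w w
  have e3 := hm v w
  have e4 := hm w v
  apply_fun ((↑) : ℝ → ℂ) at h1 h2 e1 e2 e3 e4
  unfold sqDz
  push_cast at *
  linear_combination (e1 - e2) / 4 - Complex.I / 4 * (e3 + e4) + m / 4 * h1 - Complex.I / 2 * m * h2

theorem isConformalCoord_id (F : IsAdaptedFrame ε a b c I h Φ ξ η T N) :
    IsConformalCoord Φ (I ×ˢ univ) id (I ×ˢ univ) where
  isOpen := F.isOpen.prod isOpen_univ
  mapsTo := mapsTo_id _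
  smooth := contDiff_id.contDiffOn
  injOn := injOn_id _
  pos q hq := by simpa [F.induced_eq hq.1] using F.pos _ hq.1
  same_length q hq := by simp [F.induced_eq hq.1]
  orthogonal q hq := by simp [F.induced_eq hq.1]

theorem hopfVanishes_iff (F : IsAdaptedFrame ε a b c I h Φ ξ η T N) (hb : 0 < b)
    (hI : I.Nonempty) : HopfVanishes Φ (I ×ˢ univ) ↔ a = 1 + c ^ 2 := by
  constructor
  · intro H
    obtain ⟨x, hx⟩ := hI
    have hq : ((x, 0) : ℝ × ℝ) ∈ I ×ˢ (univ : Set ℝ) := ⟨hx, trivial⟩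
    have h0 := H _ _ F.isConformalCoord_id _ hq
    rw [F.hopfCoeff_eq F.isConformalCoord_id hq] at h0
    have hε : ε ≠ 0 := fun h => by simpa [h] using F.sign
    simp [sqDz, hb.ne', hε] at h0
    norm_cast at h0
    linarith
  · rintro rfl σ V hσ q hq
    rw [F.hopfCoeff_eq hσ hq]
    simp

theorem isPMC (F : IsAdaptedFrame ε a b c I h Φ ξ η T N) (hb : 0 < b)
    (hmaps : MapsTo Φ (I ×ˢ univ) (S2 ×ˢ H2)) (hsmooth : ContDiffOn ℝ ∞ Φ (I ×ˢ univ)) :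
    IsPMC Φ (I ×ˢ univ) where
  immersion :=
    { isOpen := F.isOpen.prod isOpen_univ
      mapsTo := hmaps
      smooth := hsmooth
      injective := fun p hp => by
        rw [injective_iff_map_eq_zero]
        intro v hv
        have h1 := F.induced_eq hp.1 v v
        rw [induced, hv] at h1
        have h0 : metric 0 0 = 0 := by simp [metric, lor]
        rw [h0] at h1
        have h2 := (mul_eq_zero.1 h1.symm).resolve_left (F.pos _ hp.1).ne'
        ext <;> simp <;> nlinarith [sq_nonneg v.1, sq_nonneg v.2] }
  ne_zero p hp h0 := by
    have h1 := F.metric_meanCurv hp.1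
    rw [h0] at h1
    simp [metric, lor] at h1
    linarith
  parallel p hp v := F.normalDeriv_meanCurv hp.1 v

end IsAdaptedFrame

/-! ### Differentiating the first integral -/

/-- A non-constant smooth solution of `h' ^ 2 = P h` on an interval solves `2 h'' = P' h`, also at
the zeros of `h'`: if `2 h'' - P' h` did not vanish at `x₀`, then `h' = 0` near `x₀`, and the set
where `h` and `2 h'' - P' h` take their values at `x₀` would be open and closed in the interval. -/
theorem two_mul_deriv_deriv_eq {I : Set ℝ} (hI : IsOpen I) (hI' : I.OrdConnected) {h : ℝ → ℝ}
    (hs : ContDiffOn ℝ ∞ h I) (hn : ¬ ∃ k : ℝ, ∀ x ∈ I, h x = k) {P P' : ℝ → ℝ}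
    (hP : ∀ t, HasDerivAt P (P' t) t) (hP' : Continuous P')
    (he : ∀ x ∈ I, deriv h x ^ 2 = P (h x)) : ∀ x ∈ I, 2 * deriv (deriv h) x = P' (h x) := by
  have hs1 : ContDiffOn ℝ ∞ (deriv h) I := hs.deriv_of_isOpen hI (by simp)
  have hs2 : ContDiffOn ℝ ∞ (deriv (deriv h)) I := hs1.deriv_of_isOpen hI (by simp)
  have d0 : ∀ x ∈ I, HasDerivAt h (deriv h x) x := fun x hx =>
    ((hs.differentiableOn (by simp)).differentiableAt (hI.mem_nhds hx)).hasDerivAt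
  have d1 : ∀ x ∈ I, HasDerivAt (deriv h) (deriv (deriv h) x) x := fun x hx =>
    ((hs1.differentiableOn (by simp)).differentiableAt (hI.mem_nhds hx)).hasDerivAt
  set g : ℝ → ℝ := fun x => 2 * deriv (deriv h) x - P' (h x) with hg
  have gc : ContinuousOn g I :=
    (continuousOn_const.mul hs2.continuousOn).sub (hP'.comp_continuousOn hs.continuousOn)
  have hmul : ∀ x ∈ I, deriv h x * g x = 0 := fun x hx => by
    have e1 := (d1 x hx).fun_pow 2
    have e2 := (hP (h x)).comp x (d0 x hx)
    have ev : (fun y => deriv h y ^ 2) =ᶠ[nhds x] P ∘ h :=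
      Filter.eventually_of_mem (hI.mem_nhds hx) he
    have := e1.unique (e2.congr_of_eventuallyEq ev)
    simp only [hg]
    push_cast at this
    linear_combination this
  by_contra! hcon
  obtain ⟨x₀, hx₀, hne⟩ := hcon
  have hg0 : g x₀ ≠ 0 := sub_ne_zero.2 hne
  apply hn
  refine ⟨h x₀, ?_⟩
  have hsub : I ⊆ {x | x ∈ I ∧ h x = h x₀ ∧ g x = g x₀} := by
    refine (isPreconnected_iff_ordConnected.2 hI').subset_of_closure_inter_subset
      (isOpen_iff_mem_nhds.2 ?_) ⟨x₀, hx₀, hx₀, rfl, rfl⟩ ?_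
    · rintro x ⟨hx, hhx, hgx⟩
      have ev : ∀ᶠ y in nhds x, y ∈ I ∧ g y ≠ 0 :=
        (hI.eventually_mem hx).and
          ((gc.continuousAt (hI.mem_nhds hx)).eventually_ne (hgx ▸ hg0))
      obtain ⟨r, hr, hball⟩ := Metric.eventually_nhds_iff_ball.1 ev
      have hz : ∀ y ∈ Metric.ball x r, deriv h y = 0 := fun y hy =>
        (mul_eq_zero.1 (hmul y (hball y hy).1)).resolve_right (hball y hy).2
      have hc : ∀ y ∈ Metric.ball x r, h y = h x := fun y hy =>
        Metric.isOpen_ball.is_const_of_deriv_eq_zero (convex_ball x r).isPreconnected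
          (fun z hz => (d0 z (hball z hz).1).differentiableAt.differentiableWithinAt)
          hz hy (Metric.mem_ball_self hr)
      have hz2 : ∀ y ∈ Metric.ball x r, deriv (deriv h) y = 0 := fun y hy => by
        have : deriv h =ᶠ[nhds y] fun _ => 0 :=
          Filter.eventually_of_mem (Metric.isOpen_ball.mem_nhds hy) hz
        rw [this.deriv_eq, deriv_const]
      refine Filter.mem_of_superset (Metric.ball_mem_nhds x hr) fun y hy =>
        ⟨(hball y hy).1, (hc y hy).trans hhx, ?_⟩
      rw [← hgx]
      simp only [hg, hz2 y hy, hz2 x (Metric.mem_ball_self hr), hc y hy]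
    · rintro x ⟨hxc, hx⟩
      refine ⟨hx, ?_⟩
      have hm : ContinuousWithinAt (fun y => (h y, g y))
          {x | x ∈ I ∧ h x = h x₀ ∧ g x = g x₀} x :=
        ((hs.continuousOn x hx).prodMk (gc x hx)).mono fun y hy => hy.1
      have := hm.mem_closure hxc (t := {(h x₀, g x₀)})
        fun y hy => by simp [hy.2.1, hy.2.2]
      simpa using this
  exact fun x hx => (hsub hx).2.1

/-! ### Curves in the sphere and in the hyperbolic plane -/

/-- The Euclidean (`δ = 1`) and the Minkowski (`δ = -1`) inner product on `ℝ³`. The quadric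
`form δ p p = δ` is the sphere for `δ = 1` and contains the hyperbolic plane for `δ = -1`. -/
def form (δ : ℝ) (p q : R3) : ℝ := p 0 * q 0 + p 1 * q 1 + δ * (p 2 * q 2)

/-- The rotation by a right angle in the tangent plane at `p` of the quadric `form δ p p = δ`. -/
def rot (δ : ℝ) (p X : R3) : R3 :=
  ![p 1 * X 2 - p 2 * X 1, p 2 * X 0 - p 0 * X 2, δ * (p 0 * X 1 - p 1 * X 0)]

/-- The orthogonal projection onto the tangent plane at `p` of the quadric `form δ p p = δ`. -/
def tproj (δ : ℝ) (p X : R3) : R3 := X - (δ * form δ X p) • p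

theorem dot_eq_form (p q : R3) : p ⬝ᵥ q = form 1 p q := by rw [dot_eq, form]; ring

theorem lor_eq_form (p q : R3) : lor p q = form (-1) p q := by rw [lor_eq, form]; ring

theorem rotS2_eq_rot (p X : R3) : rotS2 p X = rot 1 p X := by
  simp [rotS2, rot, cross_apply]

theorem rotH2_eq_rot (p X : R3) : rotH2 p X = rot (-1) p X := by
  simp [rotH2, rot, cross_apply]

theorem projS2_eq_tproj (p X : R3) : projS2 p X = tproj 1 p X := by
  simp [projS2, tproj, dot_eq_form]

theorem projH2_eq_tproj (p X : R3) : projH2 p X = tproj (-1) p X := by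
  simp [projH2, tproj, lor_eq_form]

section

variable {δ : ℝ}

theorem form_comm (p q : R3) : form δ p q = form δ q p := by unfold form; ring

theorem form_add_left (p q r : R3) : form δ (p + q) r = form δ p r + form δ q r := by
  simp [form]; ring

theorem form_smul_left (k : ℝ) (p q : R3) : form δ (k • p) q = k * form δ p q := by
  simp [form]; ring

theorem form_add_right (p q r : R3) : form δ r (p + q) = form δ r p + form δ r q := by
  simp [form]; ring

theorem form_smul_right (k : ℝ) (p q : R3) : form δ p (k • q) = k * form δ p q := by
  simp [form]; ring

theorem form_rot_left (p X : R3) (hδ : δ * δ = 1) : form δ p (rot δ p X) = 0 := by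
  simp [form, rot]; linear_combination p 2 * (p 0 * X 1 - p 1 * X 0) * hδ

theorem form_rot_right (p X : R3) (hδ : δ * δ = 1) : form δ X (rot δ p X) = 0 := by
  simp [form, rot]; linear_combination X 2 * (p 0 * X 1 - p 1 * X 0) * hδ

theorem form_rot_rot (p X : R3) (hδ : δ * δ = 1) :
    form δ (rot δ p X) (rot δ p X) = δ * (form δ p p * form δ X X - form δ p X ^ 2) := by
  rcases mul_self_eq_one_iff.1 hδ with rfl | rfl <;> simp [form, rot] <;> ring

theorem rot_rot (p X : R3) (hδ : δ * δ = 1) :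
    rot δ p (rot δ p X) = (δ * form δ p X) • p - (δ * form δ p p) • X := by
  rcases mul_self_eq_one_iff.1 hδ with rfl | rfl <;> ext i <;> fin_cases i <;>
    simp [form, rot] <;> ring

theorem rot_add (p X Y : R3) : rot δ p (X + Y) = rot δ p X + rot δ p Y := by
  ext i; fin_cases i <;> simp [rot] <;> ring

theorem rot_smul (k : ℝ) (p X : R3) : rot δ p (k • X) = k • rot δ p X := by
  ext i; fin_cases i <;> simp [rot] <;> ring

theorem rot_tproj (p X : R3) : rot δ p (tproj δ p X) = rot δ p X := by
  ext i; fin_cases i <;> simp only [rot, tproj] <;> simp [-mul_eq_mul_left_iff] <;> ring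

theorem tproj_of_form_eq_zero {p X : R3} (hX : form δ X p = 0) : tproj δ p X = X := by
  simp [tproj, hX]

/-- Expansion of a tangent vector in the orthogonal frame of a tangent vector `T` and its rotation
by a right angle. -/
theorem form_smul_tproj {p T : R3} (X : R3) (hδ : δ * δ = 1) (hp : form δ p p = δ)
    (hT : form δ p T = 0) :
    form δ T T • tproj δ p X = form δ X T • T + form δ X (rot δ p T) • rot δ p T := by
  have key : ∀ i, (δ * (form δ p p * form δ T T - form δ p T ^ 2)) * X i =
      δ * (form δ X p * form δ T T - form δ X T * form δ p T) * p i +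
      δ * (form δ p p * form δ X T - form δ X p * form δ p T) * T i +
      form δ X (rot δ p T) * rot δ p T i := by
    intro i
    rcases mul_self_eq_one_iff.1 hδ with rfl | rfl <;> fin_cases i <;> simp [form, rot] <;> ring
  ext i
  have := key i
  rw [hp, hT] at this
  simp only [tproj, Pi.smul_apply, Pi.sub_apply, Pi.add_apply, smul_eq_mul]
  linear_combination this + (form δ X T * T i - form δ T T * X i) * hδ

theorem hasDerivAt_form {f g : ℝ → R3} {f' g' : R3} {x : ℝ} (hf : HasDerivAt f f' x)
    (hg : HasDerivAt g g' x) :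
    HasDerivAt (fun t => form δ (f t) (g t)) (form δ f' (g x) + form δ (f x) g') x := by
  have hf := hasDerivAt_pi.1 hf
  have hg := hasDerivAt_pi.1 hg
  have key := (((hf 0).fun_mul (hg 0)).fun_add ((hf 1).fun_mul (hg 1))).fun_add
    (((hf 2).fun_mul (hg 2)).const_mul δ)
  refine key.congr_deriv ?_
  unfold form
  ring

theorem hasDerivAt_rot {f g : ℝ → R3} {f' g' : R3} {x : ℝ} (hf : HasDerivAt f f' x)
    (hg : HasDerivAt g g' x) :
    HasDerivAt (fun t => rot δ (f t) (g t)) (rot δ f' (g x) + rot δ (f x) g') x := by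
  have hf := hasDerivAt_pi.1 hf
  have hg := hasDerivAt_pi.1 hg
  refine hasDerivAt_pi.2 fun i => ?_
  fin_cases i
  · refine (((hf 1).fun_mul (hg 2)).fun_sub ((hf 2).fun_mul (hg 1))).congr_deriv ?_
    simp [rot]; ring
  · refine (((hf 2).fun_mul (hg 0)).fun_sub ((hf 0).fun_mul (hg 2))).congr_deriv ?_
    simp [rot]; ring
  · refine ((((hf 0).fun_mul (hg 1)).fun_sub ((hf 1).fun_mul (hg 0))).const_mul δ).congr_deriv ?_
    simp [rot]; ring

/-- The Frenet equations, along the curve `γ` in the quadric `form δ p p = δ`, of its velocity `T`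
and of the field `N` obtained from `T` by a rotation by a right angle, for the squared speed
`b (1 + (h - c) ^ 2)` and for the product `b L` of the curvature with the third power of the speed,
up to sign. -/
structure IsFrenetCurve (δ b c : ℝ) (I : Set ℝ) (h L : ℝ → ℝ) (γ N : ℝ → R3) : Prop where
  form_self : ∀ x ∈ I, form δ (γ x) (γ x) = δ
  contDiffOn : ContDiffOn ℝ ∞ γ I
  diff_T : ∀ x ∈ I, DifferentiableAt ℝ (deriv γ) x
  diff_N : ∀ x ∈ I, DifferentiableAt ℝ N x
  form_T : ∀ x ∈ I, form δ (deriv γ x) (γ x) = 0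
  form_N : ∀ x ∈ I, form δ (N x) (γ x) = 0
  T_T : ∀ x ∈ I, form δ (deriv γ x) (deriv γ x) = b * (1 + (h x - c) ^ 2)
  N_N : ∀ x ∈ I, form δ (N x) (N x) = b * (1 + (h x - c) ^ 2)
  T_N : ∀ x ∈ I, form δ (deriv γ x) (N x) = 0
  cov_T : ∀ x ∈ I, tproj δ (γ x) (deriv (deriv γ) x) =
    ((h x - c) * deriv h x / (1 + (h x - c) ^ 2)) • deriv γ x - (L x / (1 + (h x - c) ^ 2)) • N x
  cov_N : ∀ x ∈ I, tproj δ (γ x) (deriv N x) =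
    ((h x - c) * deriv h x / (1 + (h x - c) ^ 2)) • N x + (L x / (1 + (h x - c) ^ 2)) • deriv γ x

theorem isFrenetCurve {b c : ℝ} (hδ : δ * δ = 1) (hb : 0 < b) {I : Set ℝ} (hI : IsOpen I)
    {h L : ℝ → ℝ} (hh : ∀ x ∈ I, HasDerivAt h (deriv h x) x) (o : ℤˣ) {γ : ℝ → R3}
    (hγ : ContDiffOn ℝ ∞ γ I) (hmem : ∀ x ∈ I, form δ (γ x) (γ x) = δ)
    (hspeed : ∀ x ∈ I, √(form δ (deriv γ x) (deriv γ x)) = √(b * (1 + (h x - c) ^ 2)))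
    (hcurv : ∀ x ∈ I, ((o : ℤ) : ℝ) *
        form δ (tproj δ (γ x) (deriv (deriv γ) x)) (rot δ (γ x) (deriv γ x)) /
          √(form δ (deriv γ x) (deriv γ x)) ^ 3 =
      -(b * L x) / √(form δ (deriv γ x) (deriv γ x)) ^ 3) :
    IsFrenetCurve δ b c I h L γ (fun x => ((o : ℤ) : ℝ) • rot δ (γ x) (deriv γ x)) := by
  have ho : ((o : ℤ) : ℝ) * ((o : ℤ) : ℝ) = 1 := by
    rcases Int.units_eq_one_or o with rfl | rfl <;> simp
  generalize ((o : ℤ) : ℝ) = s at *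
  have hs1 : ContDiffOn ℝ ∞ (deriv γ) I := hγ.deriv_of_isOpen hI (by simp)
  have d0 : ∀ x ∈ I, HasDerivAt γ (deriv γ x) x := fun x hx =>
    ((hγ.differentiableOn (by simp)).differentiableAt (hI.mem_nhds hx)).hasDerivAt
  have d1 : ∀ x ∈ I, HasDerivAt (deriv γ) (deriv (deriv γ) x) x := fun x hx =>
    ((hs1.differentiableOn (by simp)).differentiableAt (hI.mem_nhds hx)).hasDerivAt
  have hw : ∀ x, 0 < 1 + (h x - c) ^ 2 := fun x => by positivity
  have hpos : ∀ x ∈ I, 0 < √(form δ (deriv γ x) (deriv γ x)) := fun x hx => by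
    rw [hspeed x hx]
    exact Real.sqrt_pos.2 (mul_pos hb (hw x))
  have TT : ∀ x ∈ I, form δ (deriv γ x) (deriv γ x) = b * (1 + (h x - c) ^ 2) := fun x hx =>
    (Real.sqrt_inj (Real.sqrt_pos.1 (hpos x hx)).le (mul_pos hb (hw x)).le).1 (hspeed x hx)
  have Tγ : ∀ x ∈ I, form δ (deriv γ x) (γ x) = 0 := fun x hx => by
    have e1 := hasDerivAt_form (δ := δ) (d0 x hx) (d0 x hx)
    have ev : (fun y => form δ (γ y) (γ y)) =ᶠ[nhds x] fun _ => δ :=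
      Filter.eventually_of_mem (hI.mem_nhds hx) hmem
    have := e1.unique ((hasDerivAt_const x δ).congr_of_eventuallyEq ev)
    rw [form_comm (γ x)] at this
    linarith
  -- The tangential part of the acceleration comes from the speed, the normal part from the curvature.
  have AT : ∀ x ∈ I, form δ (deriv (deriv γ) x) (deriv γ x) =
      b * ((h x - c) * deriv h x) := fun x hx => by
    have e1 := hasDerivAt_form (δ := δ) (d1 x hx) (d1 x hx)
    have ev : (fun y => form δ (deriv γ y) (deriv γ y)) =ᶠ[nhds x]
        fun y => b * (1 + (h y - c) ^ 2) := Filter.eventually_of_mem (hI.mem_nhds hx) TT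
    have e2 := ((((hh x hx).sub_const c).fun_pow 2).const_add 1).const_mul b
    have := e1.unique (e2.congr_of_eventuallyEq ev)
    rw [form_comm (deriv γ x)] at this
    push_cast at this
    linarith
  have AN : ∀ x ∈ I, s * form δ (deriv (deriv γ) x) (rot δ (γ x) (deriv γ x)) = -(b * L x) :=
    fun x hx => by
      have := hcurv x hx
      rw [div_left_inj' (pow_pos (hpos x hx) 3).ne'] at this
      rw [← this, tproj, sub_eq_add_neg, ← neg_smul, form_add_left, form_smul_left,
        form_rot_left _ _ hδ]
      ring
  have NN : ∀ x ∈ I, form δ (rot δ (γ x) (deriv γ x)) (rot δ (γ x) (deriv γ x)) =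
      b * (1 + (h x - c) ^ 2) := fun x hx => by
    rw [form_rot_rot _ _ hδ, hmem x hx, form_comm (γ x), Tγ x hx, TT x hx]
    linear_combination b * (1 + (h x - c) ^ 2) * hδ
  have covT : ∀ x ∈ I, tproj δ (γ x) (deriv (deriv γ) x) =
      ((h x - c) * deriv h x / (1 + (h x - c) ^ 2)) • deriv γ x -
        (L x / (1 + (h x - c) ^ 2)) • s • rot δ (γ x) (deriv γ x) := fun x hx => by
    have key := form_smul_tproj (deriv (deriv γ) x) hδ (hmem x hx)
      ((form_comm _ _).trans (Tγ x hx))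
    have e : form δ (deriv (deriv γ) x) (rot δ (γ x) (deriv γ x)) = -(b * L x) * s := by
      linear_combination s * AN x hx - form δ (deriv (deriv γ) x) (rot δ (γ x) (deriv γ x)) * ho
    have hne : b * (1 + (h x - c) ^ 2) ≠ 0 := (mul_pos hb (hw x)).ne'
    rw [AT x hx, e, TT x hx] at key
    rw [← smul_right_injective R3 hne |>.eq_iff]
    rw [key]
    have := (hw x).ne'
    match_scalars <;> field_simp
  have dN : ∀ x ∈ I, HasDerivAt (fun x => s • rot δ (γ x) (deriv γ x))
      (s • rot δ (γ x) (deriv (deriv γ) x)) x := fun x hx => by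
    refine ((hasDerivAt_rot (d0 x hx) (d1 x hx)).fun_const_smul s).congr_deriv ?_
    have : rot δ (deriv γ x) (deriv γ x) = 0 := by
      ext i; fin_cases i <;> simp [rot, mul_comm]
    rw [this, zero_add]
  exact
  { form_self := hmem
    contDiffOn := hγ
    diff_T := fun x hx => (d1 x hx).differentiableAt
    diff_N := fun x hx => (dN x hx).differentiableAt
    form_T := Tγ
    form_N := fun x hx => by
      rw [form_smul_left, form_comm, form_rot_left _ _ hδ, mul_zero]
    T_T := TT
    N_N := fun x hx => by
      rw [form_smul_left, form_smul_right, NN x hx]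
      linear_combination b * (1 + (h x - c) ^ 2) * ho
    T_N := fun x hx => by rw [form_smul_right, form_rot_right _ _ hδ, mul_zero]
    cov_T := covT
    cov_N := fun x hx => by
      have e : tproj δ (γ x) (deriv (fun x => s • rot δ (γ x) (deriv γ x)) x) =
          s • rot δ (γ x) (deriv (deriv γ) x) := by
        rw [(dN x hx).deriv, tproj_of_form_eq_zero]
        rw [form_smul_left, form_comm, form_rot_left _ _ hδ, mul_zero]
      rw [e, ← rot_tproj, covT x hx, sub_eq_add_neg, ← neg_smul, rot_add, rot_smul, rot_smul,
        rot_smul, rot_rot _ _ hδ, form_comm, Tγ x hx, hmem x hx, hδ]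
      rw [mul_zero, zero_smul, zero_sub]
      match_scalars
      · ring
      · linear_combination L x / (1 + (h x - c) ^ 2) * ho }

end

/-! ### The rotational maps -/

/-- A map `P` of `(t, y)` into the quadric `form ε p p = ε`, with partial derivatives `Q` and `R`:
the Gauss equations of an orthogonal parametrization with `|Q|² = 1 / L`, `|R|² = L`, where
`L = ε (a - t ^ 2)`, and with the lines `y = const` as geodesics. -/
structure IsRotationalMap (ε a : ℝ) (S : Set ℝ) (P Q R : ℝ × ℝ → R3) : Prop where
  hasFDerivAt : ∀ z : ℝ × ℝ, z.1 ∈ S → HasFDerivAt P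
    ((ContinuousLinearMap.fst ℝ ℝ ℝ).smulRight (Q z)
      + (ContinuousLinearMap.snd ℝ ℝ ℝ).smulRight (R z)) z
  hasFDerivAt_Q : ∀ z : ℝ × ℝ, z.1 ∈ S → HasFDerivAt Q
    ((ContinuousLinearMap.fst ℝ ℝ ℝ).smulRight
        ((ε * z.1 / (ε * (a - z.1 ^ 2))) • Q z - (ε / (ε * (a - z.1 ^ 2))) • P z)
      + (ContinuousLinearMap.snd ℝ ℝ ℝ).smulRight (-(ε * z.1 / (ε * (a - z.1 ^ 2))) • R z)) z
  hasFDerivAt_R : ∀ z : ℝ × ℝ, z.1 ∈ S → HasFDerivAt R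
    ((ContinuousLinearMap.fst ℝ ℝ ℝ).smulRight (-(ε * z.1 / (ε * (a - z.1 ^ 2))) • R z)
      + (ContinuousLinearMap.snd ℝ ℝ ℝ).smulRight
        ((ε * (ε * (a - z.1 ^ 2)) * z.1) • Q z - (ε * (ε * (a - z.1 ^ 2))) • P z)) z
  contDiffAt : ∀ z : ℝ × ℝ, z.1 ∈ S → ContDiffAt ℝ ∞ P z
  P_P : ∀ z : ℝ × ℝ, z.1 ∈ S → form ε (P z) (P z) = ε
  Q_P : ∀ z : ℝ × ℝ, z.1 ∈ S → form ε (Q z) (P z) = 0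
  R_P : ∀ z : ℝ × ℝ, z.1 ∈ S → form ε (R z) (P z) = 0
  Q_Q : ∀ z : ℝ × ℝ, z.1 ∈ S → form ε (Q z) (Q z) = 1 / (ε * (a - z.1 ^ 2))
  R_R : ∀ z : ℝ × ℝ, z.1 ∈ S → form ε (R z) (R z) = ε * (a - z.1 ^ 2)
  Q_R : ∀ z : ℝ × ℝ, z.1 ∈ S → form ε (Q z) (R z) = 0

theorem hasFDerivAt_comp_fst {E : Type*} [NormedAddCommGroup E] [NormedSpace ℝ E] {f : ℝ → E}
    {f' : E} {z : ℝ × ℝ} (hf : HasDerivAt f f' z.1) :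
    HasFDerivAt (fun q : ℝ × ℝ => f q.1) ((ContinuousLinearMap.fst ℝ ℝ ℝ).smulRight f') z :=
  (hf.hasFDerivAt.comp z hasFDerivAt_fst).congr_fderiv (by ext <;> simp)

theorem hasFDerivAt_comp_snd {E : Type*} [NormedAddCommGroup E] [NormedSpace ℝ E] {f : ℝ → E}
    {f' : E} {z : ℝ × ℝ} (hf : HasDerivAt f f' z.2) :
    HasFDerivAt (fun q : ℝ × ℝ => f q.2) ((ContinuousLinearMap.snd ℝ ℝ ℝ).smulRight f') z :=
  (hf.hasFDerivAt.comp z hasFDerivAt_snd).congr_fderiv (by ext <;> simp)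

theorem hasFDerivAt_smul_add_smul {f g : ℝ → ℝ} {f' g' : ℝ} {C : ℝ → R3} {C' K : R3} {z : ℝ × ℝ}
    (hf : HasDerivAt f f' z.1) (hg : HasDerivAt g g' z.1) (hC : HasDerivAt C C' z.2) :
    HasFDerivAt (fun q : ℝ × ℝ => f q.1 • C q.2 + g q.1 • K)
      ((ContinuousLinearMap.fst ℝ ℝ ℝ).smulRight (f' • C z.2 + g' • K)
        + (ContinuousLinearMap.snd ℝ ℝ ℝ).smulRight (f z.1 • C')) z := by
  refine (((hasFDerivAt_comp_fst hf).fun_smul (hasFDerivAt_comp_snd hC)).fun_add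
    ((hasFDerivAt_comp_fst hg).smul_const K)).congr_fderiv ?_
  ext <;> simp

/-- The rotational map `√(ε (a - t ^ 2)) C(y) + t K` about the axis `K`, of elliptic or hyperbolic
type according to the sign of `a` in the equation `C'' = -a C` of the orbits. -/
theorem isRotationalMap_sqrt {ε a : ℝ} (hε : ε * ε = 1) (ha : a ≠ 0) {C D : ℝ → R3} {K : R3}
    (hC : ∀ y, HasDerivAt C (D y) y) (hD : ∀ y, HasDerivAt D (-a • C y) y)
    (hsmooth : ContDiff ℝ ∞ C)
    (CC : ∀ y, form ε (C y) (C y) = 1 / a) (KK : form ε K K = ε / a)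
    (CK : ∀ y, form ε (C y) K = 0) (DD : ∀ y, form ε (D y) (D y) = 1)
    (CD : ∀ y, form ε (C y) (D y) = 0) (DK : ∀ y, form ε (D y) K = 0) :
    IsRotationalMap ε a {t | 0 < ε * (a - t ^ 2)}
      (fun z => √(ε * (a - z.1 ^ 2)) • C z.2 + z.1 • K)
      (fun z => (-(ε * z.1) / √(ε * (a - z.1 ^ 2))) • C z.2 + (1 : ℝ) • K)
      (fun z => √(ε * (a - z.1 ^ 2)) • D z.2) := by
  have dr : ∀ t, 0 < ε * (a - t ^ 2) →
      HasDerivAt (fun t => √(ε * (a - t ^ 2))) (-(ε * t) / √(ε * (a - t ^ 2))) t := fun t ht => by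
    have := ((((hasDerivAt_id t).fun_pow 2).const_sub a).const_mul ε).sqrt ht.ne'
    refine this.congr_deriv ?_
    have hr := (Real.sqrt_pos.2 ht).ne'
    simp
    field_simp
  have hsq : ∀ t, 0 < ε * (a - t ^ 2) → √(ε * (a - t ^ 2)) ^ 2 = ε * (a - t ^ 2) :=
    fun t ht => Real.sq_sqrt ht.le
  refine ⟨?_, ?_, ?_, ?_, ?_, ?_, ?_, ?_, ?_, ?_⟩ <;> intro z (hz : 0 < ε * (a - z.1 ^ 2)) <;>
    have hr := (Real.sqrt_pos.2 hz).ne' <;> have h2 := hsq _ hz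
  · exact hasFDerivAt_smul_add_smul (dr _ hz) (hasDerivAt_id z.1) (hC z.2)
  · refine (hasFDerivAt_smul_add_smul (((hasDerivAt_id z.1).const_mul ε).fun_neg.fun_div (dr _ hz) hr)
      (hasDerivAt_const z.1 (1 : ℝ)) (hC z.2)).congr_fderiv ?_
    generalize √(ε * (a - z.1 ^ 2)) = r at hr h2
    rw [← h2]
    congr 2
    · match_scalars
      · simp only [id]
        field_simp
        ring
      · ring
    · match_scalars
      simp only [id]
      field_simp
  · refine ((hasFDerivAt_smul_add_smul (K := 0) (dr _ hz) (hasDerivAt_id z.1)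
      (hD z.2)).congr_of_eventuallyEq (.of_forall fun q => by simp)).congr_fderiv ?_
    generalize √(ε * (a - z.1 ^ 2)) = r at hr h2
    rw [← h2]
    congr 2
    · match_scalars
      field_simp
    · match_scalars
      · field_simp
        linear_combination ε * h2 + a * hε
      · ring
  · have : ContDiffAt ℝ ∞ (fun z : ℝ × ℝ => ε * (a - z.1 ^ 2)) z := by fun_prop
    exact ((this.sqrt hz.ne').smul (hsmooth.contDiffAt.comp z contDiffAt_snd)).add
      (contDiffAt_fst.smul contDiffAt_const)
  all_goals
    simp only [form_add_left, form_add_right, form_smul_left, form_smul_right, CC, KK, CK, DD, CD,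
      DK, form_comm K (C z.2), form_comm (D z.2) (C z.2)]
  all_goals generalize √(ε * (a - z.1 ^ 2)) = r at hr h2
  · field_simp
    linear_combination h2
  · field_simp
    ring
  · ring
  · rw [← h2]
    field_simp
    linear_combination ε * h2 + a * hε
  · linear_combination h2
  · rw [form_comm K, DK]
    ring

/-- The parabolic rotational map into the hyperbolic plane, about a light-like axis. -/
theorem isRotationalMap_parabolic :
    IsRotationalMap (-1) 0 {t | 0 < t}
      (fun z => z.1 • ![(z.2 ^ 2 - 1) / 2, z.2, (z.2 ^ 2 + 1) / 2] + z.1⁻¹ • ![1 / 2, 0, 1 / 2])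
      (fun z => (1 : ℝ) • ![(z.2 ^ 2 - 1) / 2, z.2, (z.2 ^ 2 + 1) / 2]
        + (-(z.1 ^ 2)⁻¹) • ![1 / 2, 0, 1 / 2])
      (fun z => z.1 • ![z.2, 1, z.2]) := by
  have hC : ∀ y : ℝ, HasDerivAt (fun y : ℝ => ![(y ^ 2 - 1) / 2, y, (y ^ 2 + 1) / 2]) ![y, 1, y] y :=
    fun y => by
      refine hasDerivAt_pi.2 fun i => ?_
      fin_cases i
      · exact ((((hasDerivAt_id y).fun_pow 2).sub_const 1).div_const 2).congr_deriv (by simp)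
      · exact hasDerivAt_id y
      · exact ((((hasDerivAt_id y).fun_pow 2).add_const 1).div_const 2).congr_deriv (by simp)
  have hD : ∀ y : ℝ, HasDerivAt (fun y : ℝ => ![y, 1, y]) ![1, 0, 1] y := fun y => by
    refine hasDerivAt_pi.2 fun i => ?_
    fin_cases i
    · exact hasDerivAt_id y
    · exact hasDerivAt_const y 1
    · exact hasDerivAt_id y
  have hsmooth : ContDiff ℝ ∞ (fun y : ℝ => ![(y ^ 2 - 1) / 2, y, (y ^ 2 + 1) / 2]) := by
    refine contDiff_pi.2 fun i => ?_
    fin_cases i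
    · exact ((contDiff_id.pow 2).sub contDiff_const).div_const 2
    · exact contDiff_id
    · exact ((contDiff_id.pow 2).add contDiff_const).div_const 2
  refine ⟨?_, ?_, ?_, ?_, ?_, ?_, ?_, ?_, ?_, ?_⟩ <;> intro z (hz : 0 < z.1) <;> have hz' := hz.ne'
  · exact hasFDerivAt_smul_add_smul (hasDerivAt_id z.1) (hasDerivAt_inv hz') (hC z.2)
  · refine (hasFDerivAt_smul_add_smul (hasDerivAt_const z.1 (1 : ℝ))
      (((hasDerivAt_id z.1).fun_pow 2).fun_inv (pow_ne_zero 2 hz')).fun_neg (hC z.2)).congr_fderiv ?_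
    congr 2
    · ext i
      fin_cases i <;> simp <;> field_simp <;> ring
    · ext i
      fin_cases i <;> simp <;> field_simp
  · refine ((hasFDerivAt_smul_add_smul (K := 0) (hasDerivAt_id z.1) (hasDerivAt_id z.1)
      (hD z.2)).congr_of_eventuallyEq (.of_forall fun q => by simp)).congr_fderiv ?_
    congr 2
    · ext i
      fin_cases i <;> simp <;> field_simp
    · ext i
      fin_cases i <;> simp <;> field_simp <;> ring
  · exact (contDiffAt_fst.smul (hsmooth.contDiffAt.comp z contDiffAt_snd)).add
      ((contDiffAt_fst.inv hz').smul contDiffAt_const)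
  all_goals simp [form] <;> field_simp <;> ring

/-! ### The adapted frame of a rotational map and a curve -/

/-- `ι₁` and `ι₂` are the inclusions of the two factors `ℝ³` of the ambient space, the first one
being the factor with the form of sign `ε`. -/
structure IsSplitting (ε : ℝ) (ι₁ ι₂ : R3 →L[ℝ] R6) : Prop where
  metric_fst : ∀ X Y, metric (ι₁ X) (ι₁ Y) = form ε X Y
  metric_snd : ∀ X Y, metric (ι₂ X) (ι₂ Y) = form (-ε) X Y
  metric_fst_snd : ∀ X Y, metric (ι₁ X) (ι₂ Y) = 0
  proj_fst : ∀ P Q X, proj (ι₁ P + ι₂ Q) (ι₁ X) = ι₁ (tproj ε P X)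
  proj_snd : ∀ P Q X, proj (ι₁ P + ι₂ Q) (ι₂ X) = ι₂ (tproj (-ε) Q X)
  prodStr_fst : ∀ X, prodStr (ι₁ X) = ε • ι₁ X
  prodStr_snd : ∀ X, prodStr (ι₂ X) = -ε • ι₂ X

theorem isSplitting_inl_inr :
    IsSplitting 1 (ContinuousLinearMap.inl ℝ R3 R3) (ContinuousLinearMap.inr ℝ R3 R3) := by
  constructor <;> intros <;>
    simp [metric, dot_eq_form, lor_eq_form, proj, prodStr, projS2_eq_tproj, projH2_eq_tproj] <;>
    simp [form, tproj]

theorem isSplitting_inr_inl :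
    IsSplitting (-1) (ContinuousLinearMap.inr ℝ R3 R3) (ContinuousLinearMap.inl ℝ R3 R3) := by
  constructor <;> intros <;>
    simp [metric, dot_eq_form, lor_eq_form, proj, prodStr, projS2_eq_tproj, projH2_eq_tproj] <;>
    simp [form, tproj]

theorem HasCovDerivs.of_hasFDerivAt {ι : R3 →L[ℝ] R6} {Φ : ℝ × ℝ → R6} {W : ℝ × ℝ → R3}
    {δ : ℝ} {p : ℝ × ℝ} {X Y A B n : R3}
    (hproj : ∀ Z, proj (Φ p) (ι Z) = ι (tproj δ n Z))
    (hW : HasFDerivAt W ((ContinuousLinearMap.fst ℝ ℝ ℝ).smulRight X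
      + (ContinuousLinearMap.snd ℝ ℝ ℝ).smulRight Y) p)
    (ht : form δ (W p) n = 0) (hX : tproj δ n X = A) (hY : tproj δ n Y = B) :
    HasCovDerivs Φ (fun q => ι (W q)) p (ι A) (ι B) := by
  have hd := ι.hasFDerivAt.comp p hW
  refine ⟨hd.differentiableAt, by rw [hproj, tproj_of_form_eq_zero ht], fun v => ?_⟩
  unfold covDeriv
  have : fderiv ℝ (fun q => ι (W q)) p = _ := hd.fderiv
  rw [this]
  simp only [ContinuousLinearMap.comp_apply, _root_.add_apply,
    ContinuousLinearMap.smulRight_apply, ContinuousLinearMap.coe_fst', ContinuousLinearMap.coe_snd',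
    map_add, map_smul, proj_add, proj_smul, hproj, hX, hY]

theorem tproj_sub_smul {δ : ℝ} {n X : R3} (k : ℝ) (hδ : δ * δ = 1) (hn : form δ n n = δ)
    (hX : form δ X n = 0) : tproj δ n (X - k • n) = X := by
  rw [tproj, sub_eq_add_neg X, ← neg_smul, form_add_left, form_smul_left, hX, hn]
  match_scalars
  · ring
  · linear_combination k * hδ

theorem isAdaptedFrame {ε a b c : ℝ} (hε : ε * ε = 1) {I S : Set ℝ} (hI : IsOpen I)
    (hI' : I.OrdConnected) {h : ℝ → ℝ} (hs : ContDiffOn ℝ ∞ h I)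
    (hn : ¬ ∃ k : ℝ, ∀ x ∈ I, h x = k) (hpos : ∀ x ∈ I, 0 < ε * (a - h x ^ 2))
    (hfirst : ∀ x ∈ I, deriv h x ^ 2 =
      (ε * (a - h x ^ 2)) ^ 2 - ε * (a - h x ^ 2) * (b * (1 + (h x - c) ^ 2)))
    {ι₁ ι₂ : R3 →L[ℝ] R6} (hι : IsSplitting ε ι₁ ι₂) {P Q R : ℝ × ℝ → R3}
    (hP : IsRotationalMap ε a S P Q R) (hS : ∀ x ∈ I, h x ∈ S) {γ N : ℝ → R3}
    (hγ : IsFrenetCurve (-ε) b c I h (fun x => ε * (a - h x ^ 2)) γ N) :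
    IsAdaptedFrame ε a b c I h (fun p => ι₁ (P (h p.1, p.2)) + ι₂ (γ p.1))
      (fun p => ι₁ (Q (h p.1, p.2))) (fun p => ι₁ (R (h p.1, p.2)))
      (fun p => ι₂ (deriv γ p.1)) (fun p => ι₂ (N p.1)) := by
  have hs1 : ContDiffOn ℝ ∞ (deriv h) I := hs.deriv_of_isOpen hI (by simp)
  have d0 : ∀ x ∈ I, HasDerivAt h (deriv h x) x := fun x hx =>
    ((hs.differentiableOn (by simp)).differentiableAt (hI.mem_nhds hx)).hasDerivAt
  have d1 : ∀ x ∈ I, HasDerivAt (deriv h) (deriv (deriv h) x) x := fun x hx =>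
    ((hs1.differentiableOn (by simp)).differentiableAt (hI.mem_nhds hx)).hasDerivAt
  have dγ : ∀ x ∈ I, HasDerivAt γ (deriv γ x) x := fun x hx =>
    ((hγ.contDiffOn.differentiableOn (by simp)).differentiableAt (hI.mem_nhds hx)).hasDerivAt
  have dcomp : ∀ p : ℝ × ℝ, p.1 ∈ I → ∀ {W : ℝ × ℝ → R3} {X Y : R3},
      HasFDerivAt W ((ContinuousLinearMap.fst ℝ ℝ ℝ).smulRight X
        + (ContinuousLinearMap.snd ℝ ℝ ℝ).smulRight Y) (h p.1, p.2) →
      HasFDerivAt (fun q : ℝ × ℝ => W (h q.1, q.2))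
        ((ContinuousLinearMap.fst ℝ ℝ ℝ).smulRight (deriv h p.1 • X)
          + (ContinuousLinearMap.snd ℝ ℝ ℝ).smulRight Y) p := fun p hp W X Y hW => by
    have e := (hasFDerivAt_comp_fst (d0 _ hp)).prodMk (hasFDerivAt_snd (𝕜 := ℝ) (p := p))
    refine (hW.comp p e).congr_fderiv ?_
    ext <;> simp
  have dcurve : ∀ p : ℝ × ℝ, ∀ {W : ℝ → R3} {X : R3}, HasDerivAt W X p.1 →
      HasFDerivAt (fun q : ℝ × ℝ => W q.1) ((ContinuousLinearMap.fst ℝ ℝ ℝ).smulRight X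
        + (ContinuousLinearMap.snd ℝ ℝ ℝ).smulRight 0) p := fun p W X hW =>
    (hasFDerivAt_comp_fst hW).congr_fderiv (by ext <;> simp)
  have hε' : -ε * -ε = 1 := by linear_combination hε
  have tp_smul : ∀ (δ k : ℝ) (n X : R3), tproj δ n (k • X) = k • tproj δ n X := fun δ k n X => by
    rw [tproj, tproj, form_smul_left]; module
  have tp_zero : ∀ (δ : ℝ) (n : R3), tproj δ n 0 = 0 := fun δ n => by
    simpa using tp_smul δ 0 n 0
  exact
  { sign := hε
    isOpen := hI
    pos := hpos
    hasDerivAt := d0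
    firstIntegral := hfirst
    hasDerivAt_deriv := fun x hx => by
      refine (d1 x hx).congr_deriv ?_
      have hPol : ∀ t : ℝ, HasDerivAt
          (fun t => (ε * (a - t ^ 2)) ^ 2 - ε * (a - t ^ 2) * (b * (1 + (t - c) ^ 2)))
          (2 * (-2 * ε * t * (ε * (a - t ^ 2)) + ε * t * (b * (1 + (t - c) ^ 2))
            - ε * (a - t ^ 2) * b * (t - c))) t := fun t => by
        have e1 := (((hasDerivAt_id t).fun_pow 2).const_sub a).const_mul ε
        have e2 := ((((hasDerivAt_id t).sub_const c).fun_pow 2).const_add 1).const_mul b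
        refine ((e1.fun_pow 2).fun_sub (e1.fun_mul e2)).congr_deriv ?_
        simp only [id]
        push_cast
        ring
      have := two_mul_deriv_deriv_eq hI hI' hs hn hPol (by fun_prop) hfirst x hx
      linarith
    fderiv_eq := fun p hp v => by
      have e := (ι₁.hasFDerivAt.comp p (dcomp p hp (hP.hasFDerivAt _ (hS _ hp)))).add
        (ι₂.hasFDerivAt.comp p (dcurve p (dγ _ hp)))
      have : fderiv ℝ (fun p => ι₁ (P (h p.1, p.2)) + ι₂ (γ p.1)) p = _ := e.fderiv
      rw [this]
      simp
      module
    cov_xi := fun p hp => by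
      have hz := hS _ hp
      rw [← map_smul, ← map_smul]
      refine .of_hasFDerivAt (n := P (h p.1, p.2)) (hι.proj_fst _ _)
        (dcomp p hp (hP.hasFDerivAt_Q _ hz)) (hP.Q_P _ hz) ?_ ?_
      · rw [tp_smul, tproj_sub_smul _ hε (hP.P_P _ hz), smul_smul]
        · congr 1
          ring
        · rw [form_smul_left, hP.Q_P _ hz, mul_zero]
      · rw [tp_smul, tproj_of_form_eq_zero (hP.R_P _ hz)]
    cov_eta := fun p hp => by
      have hz := hS _ hp
      rw [← map_smul, ← map_smul]
      refine .of_hasFDerivAt (n := P (h p.1, p.2)) (hι.proj_fst _ _)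
        (dcomp p hp (hP.hasFDerivAt_R _ hz)) (hP.R_P _ hz) ?_ ?_
      · rw [tp_smul, tp_smul, tproj_of_form_eq_zero (hP.R_P _ hz), smul_smul]
        congr 1
        ring
      · rw [tproj_sub_smul _ hε (hP.P_P _ hz)]
        rw [form_smul_left, hP.Q_P _ hz, mul_zero]
    cov_T := fun p hp => by
      rw [← map_smul, ← map_smul, ← map_sub, ← map_zero ι₂]
      exact .of_hasFDerivAt (n := γ p.1) (hι.proj_snd _ _)
        (dcurve p (hγ.diff_T _ hp).hasDerivAt) (hγ.form_T _ hp) (hγ.cov_T _ hp) (tp_zero _ _)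
    cov_N := fun p hp => by
      rw [← map_smul, ← map_smul, ← map_add, ← map_zero ι₂]
      exact .of_hasFDerivAt (n := γ p.1) (hι.proj_snd _ _)
        (dcurve p (hγ.diff_N _ hp).hasDerivAt) (hγ.form_N _ hp) (hγ.cov_N _ hp) (tp_zero _ _)
    xi_xi := fun p hp => by rw [hι.metric_fst, hP.Q_Q _ (hS _ hp)]
    eta_eta := fun p hp => by rw [hι.metric_fst, hP.R_R _ (hS _ hp)]
    xi_eta := fun p hp => by rw [hι.metric_fst, hP.Q_R _ (hS _ hp)]
    T_T := fun p hp => by rw [hι.metric_snd, hγ.T_T _ hp]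
    N_N := fun p hp => by rw [hι.metric_snd, hγ.N_N _ hp]
    T_N := fun p hp => by rw [hι.metric_snd, hγ.T_N _ hp]
    xi_T := fun p _ => hι.metric_fst_snd _ _
    xi_N := fun p _ => hι.metric_fst_snd _ _
    eta_T := fun p _ => hι.metric_fst_snd _ _
    eta_N := fun p _ => hι.metric_fst_snd _ _
    prodStr_xi := fun p => hι.prodStr_fst _
    prodStr_eta := fun p => hι.prodStr_fst _
    prodStr_T := fun p => hι.prodStr_snd _ }

/-- Both families of surfaces at once: a rotational map into the factor of sign `ε` and a Frenet
curve in the other factor form a surface with parallel mean curvature. -/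
theorem isPMC_of_splitting {ε a b c : ℝ} (hε : ε * ε = 1) (hb : 0 < b) {I S : Set ℝ}
    (hI : IsOpen I) (hI' : I.OrdConnected) {h : ℝ → ℝ} (hs : ContDiffOn ℝ ∞ h I)
    (hn : ¬ ∃ k : ℝ, ∀ x ∈ I, h x = k) (hpos : ∀ x ∈ I, 0 < ε * (a - h x ^ 2))
    (hfirst : ∀ x ∈ I, deriv h x ^ 2 =
      (ε * (a - h x ^ 2)) ^ 2 - ε * (a - h x ^ 2) * (b * (1 + (h x - c) ^ 2)))
    {ι₁ ι₂ : R3 →L[ℝ] R6} (hι : IsSplitting ε ι₁ ι₂) {P Q R : ℝ × ℝ → R3}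
    (hP : IsRotationalMap ε a S P Q R) (hS : ∀ x ∈ I, h x ∈ S) {γ N : ℝ → R3}
    (hγ : IsFrenetCurve (-ε) b c I h (fun x => ε * (a - h x ^ 2)) γ N) {Φ : ℝ × ℝ → R6}
    (hΦ : ∀ p, Φ p = ι₁ (P (h p.1, p.2)) + ι₂ (γ p.1))
    (hmaps : MapsTo Φ (I ×ˢ univ) (S2 ×ˢ H2)) :
    IsPMC Φ (I ×ˢ univ) ∧
      (∀ p ∈ I ×ˢ (univ : Set ℝ), metric (meanCurv Φ p) (meanCurv Φ p) = b / 4) ∧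
      (HopfVanishes Φ (I ×ˢ univ) ↔ a = 1 + c ^ 2) := by
  obtain rfl := funext hΦ
  have F := isAdaptedFrame hε hI hI' hs hn hpos hfirst hι hP hS hγ
  have hne : I.Nonempty := by
    by_contra hempty
    exact hn ⟨0, fun x hx => (hempty ⟨x, hx⟩).elim⟩
  refine ⟨F.isPMC hb hmaps ?_, fun p hp => F.metric_meanCurv hp.1, F.hopfVanishes_iff hb hne⟩
  have e1 : ContDiffOn ℝ ∞ (fun p : ℝ × ℝ => P (h p.1, p.2)) (I ×ˢ univ) := fun p hp => by
    have e : ContDiffWithinAt ℝ ∞ (fun p : ℝ × ℝ => (h p.1, p.2)) (I ×ˢ univ) p :=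
      ((hs p.1 hp.1).comp p contDiffWithinAt_fst fun q hq => hq.1).prodMk contDiffWithinAt_snd
    exact (hP.contDiffAt (h p.1, p.2) (hS _ hp.1)).comp_contDiffWithinAt p e
  have e2 : ContDiffOn ℝ ∞ (fun p : ℝ × ℝ => γ p.1) (I ×ˢ univ) :=
    hγ.contDiffOn.comp contDiff_fst.contDiffOn fun q hq => hq.1
  exact (ι₁.contDiff.comp_contDiffOn e1).add (ι₂.contDiff.comp_contDiffOn e2)

/-! ### The three types of rotational maps -/

theorem sqrt_mul_sqrt_inv {a : ℝ} (ha : 0 < a) : (√a)⁻¹ * (√a)⁻¹ = 1 / a := by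
  rw [← mul_inv, Real.mul_self_sqrt ha.le, one_div]

/-- The rotational map with closed orbits, in the sphere and in the hyperbolic plane. -/
theorem isRotationalMap_elliptic {ε a : ℝ} (hε : ε * ε = 1) (ha : 0 < a) :
    IsRotationalMap ε a {t | 0 < ε * (a - t ^ 2)}
      (fun z => √(ε * (a - z.1 ^ 2)) •
          ![(√a)⁻¹ * Real.cos (√a * z.2), (√a)⁻¹ * Real.sin (√a * z.2), 0]
        + z.1 • ![0, 0, (√a)⁻¹])
      (fun z => (-(ε * z.1) / √(ε * (a - z.1 ^ 2))) •
          ![(√a)⁻¹ * Real.cos (√a * z.2), (√a)⁻¹ * Real.sin (√a * z.2), 0]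
        + (1 : ℝ) • ![0, 0, (√a)⁻¹])
      (fun z => √(ε * (a - z.1 ^ 2)) • ![-Real.sin (√a * z.2), Real.cos (√a * z.2), 0]) := by
  have hr := (Real.sqrt_pos.2 ha).ne'
  have ha' := sqrt_mul_sqrt_inv ha
  have haa := Real.mul_self_sqrt ha.le
  refine isRotationalMap_sqrt
    (C := fun y => ![(√a)⁻¹ * Real.cos (√a * y), (√a)⁻¹ * Real.sin (√a * y), 0])
    (D := fun y => ![-Real.sin (√a * y), Real.cos (√a * y), 0]) (K := ![0, 0, (√a)⁻¹])
    hε ha.ne' (fun y => ?_) (fun y => ?_) ?_ (fun y => ?_) ?_ (fun y => ?_)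
    (fun y => ?_) (fun y => ?_) (fun y => ?_)
  · have e : HasDerivAt (fun y => √a * y) (√a * 1) y := (hasDerivAt_id y).const_mul _
    refine hasDerivAt_pi.2 fun i => ?_
    fin_cases i
    · exact (e.cos.const_mul _).congr_deriv (by simp; field_simp)
    · exact (e.sin.const_mul _).congr_deriv (by simp; field_simp)
    · exact hasDerivAt_const y 0
  · have e : HasDerivAt (fun y => √a * y) (√a * 1) y := (hasDerivAt_id y).const_mul _
    refine hasDerivAt_pi.2 fun i => ?_
    fin_cases i
    · refine e.sin.fun_neg.congr_deriv ?_
      simp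
      field_simp
      linear_combination Real.cos (√a * y) * haa
    · refine e.cos.congr_deriv ?_
      simp
      field_simp
      linear_combination Real.sin (√a * y) * haa
    · exact (hasDerivAt_const y 0).congr_deriv (by simp)
  · refine contDiff_pi.2 fun i => ?_
    fin_cases i <;> simp <;> fun_prop
  all_goals simp only [form, Matrix.cons_val]
  · linear_combination ha' + ((√a)⁻¹ * (√a)⁻¹) * Real.sin_sq_add_cos_sq (√a * y)
  · linear_combination ε * ha'
  · ring
  · linear_combination Real.sin_sq_add_cos_sq (√a * y)
  · ring
  · ring

/-- The rotational map in the hyperbolic plane whose orbits are equidistant curves of a geodesic. -/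
theorem isRotationalMap_hyperbolic {a : ℝ} (ha : a < 0) :
    IsRotationalMap (-1) a {t | 0 < -1 * (a - t ^ 2)}
      (fun z => √(-1 * (a - z.1 ^ 2)) •
          ![0, (√(-a))⁻¹ * Real.sinh (√(-a) * z.2), (√(-a))⁻¹ * Real.cosh (√(-a) * z.2)]
        + z.1 • ![(√(-a))⁻¹, 0, 0])
      (fun z => (-(-1 * z.1) / √(-1 * (a - z.1 ^ 2))) •
          ![0, (√(-a))⁻¹ * Real.sinh (√(-a) * z.2), (√(-a))⁻¹ * Real.cosh (√(-a) * z.2)]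
        + (1 : ℝ) • ![(√(-a))⁻¹, 0, 0])
      (fun z => √(-1 * (a - z.1 ^ 2)) •
        ![0, Real.cosh (√(-a) * z.2), Real.sinh (√(-a) * z.2)]) := by
  have ha0 : 0 < -a := neg_pos.2 ha
  have hr := (Real.sqrt_pos.2 ha0).ne'
  have ha' := sqrt_mul_sqrt_inv ha0
  have haa := Real.mul_self_sqrt ha0.le
  rw [div_neg] at ha'
  refine isRotationalMap_sqrt
    (C := fun y => ![0, (√(-a))⁻¹ * Real.sinh (√(-a) * y), (√(-a))⁻¹ * Real.cosh (√(-a) * y)])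
    (D := fun y => ![0, Real.cosh (√(-a) * y), Real.sinh (√(-a) * y)]) (K := ![(√(-a))⁻¹, 0, 0])
    (by norm_num) ha.ne (fun y => ?_) (fun y => ?_) ?_ (fun y => ?_) ?_ (fun y => ?_)
    (fun y => ?_) (fun y => ?_) (fun y => ?_)
  · have e : HasDerivAt (fun y => √(-a) * y) (√(-a) * 1) y := (hasDerivAt_id y).const_mul _
    refine hasDerivAt_pi.2 fun i => ?_
    fin_cases i
    · exact hasDerivAt_const y 0
    · exact (e.sinh.const_mul _).congr_deriv (by simp; field_simp)
    · exact (e.cosh.const_mul _).congr_deriv (by simp; field_simp)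
  · have e : HasDerivAt (fun y => √(-a) * y) (√(-a) * 1) y := (hasDerivAt_id y).const_mul _
    refine hasDerivAt_pi.2 fun i => ?_
    fin_cases i
    · exact (hasDerivAt_const y 0).congr_deriv (by simp)
    · refine e.cosh.congr_deriv ?_
      simp
      field_simp
      linear_combination Real.sinh (√(-a) * y) * haa
    · refine e.sinh.congr_deriv ?_
      simp
      field_simp
      linear_combination haa
  · refine contDiff_pi.2 fun i => ?_
    fin_cases i <;> simp <;> fun_prop
  all_goals simp only [form, Matrix.cons_val]
  · linear_combination -ha' - ((√(-a))⁻¹ * (√(-a))⁻¹) * Real.cosh_sq (√(-a) * y)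
  · linear_combination ha'
  · ring
  · linear_combination Real.cosh_sq (√(-a) * y)
  · ring
  · ring

theorem mem_H2_of_form {p : R3} (hp : form (-1) p p = -1) (h2 : 0 < p 2) : p ∈ H2 :=
  ⟨(lor_eq_form p p).trans hp, h2⟩

end S2H2
end

open S2H2
theorem proposition4p3 (a b c : ℝ) (hb : 0 < b)
    (I : Set ℝ) (hI_open : IsOpen I) (hI_interval : I.OrdConnected)
    (h : ℝ → ℝ) (h_smooth : ContDiffOn ℝ ∞ h I) (h_nonconst : ¬ ∃ k : ℝ, ∀ x ∈ I, h x = k)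
    (o : ℤˣ) :
    -- the family with a map into the sphere and a curve in the hyperbolic plane
    (0 < a →
      (∀ x ∈ I, deriv h x ^ 2 =
        (a - h x ^ 2 - b * (1 + (h x - c) ^ 2)) * (a - h x ^ 2)) →
      (∀ x ∈ I, 0 < a - h x ^ 2) →
      ∀ ψ : ℝ → R3, ContDiffOn ℝ ∞ ψ I → MapsTo ψ I H2 →
        (∀ x ∈ I, speedH2 ψ x = √(b * (1 + (h x - c) ^ 2))) →
        (∀ x ∈ I, curvH2 o ψ x = -(b * (a - h x ^ 2)) / speedH2 ψ x ^ 3) →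
        IsPMC (fun p => (phiMap a h p, ψ p.1)) (I ×ˢ univ) ∧
        (∀ p ∈ I ×ˢ (univ : Set ℝ),
          metric (meanCurv (fun p => (phiMap a h p, ψ p.1)) p)
            (meanCurv (fun p => (phiMap a h p, ψ p.1)) p) = b / 4) ∧
        (HopfVanishes (fun p => (phiMap a h p, ψ p.1)) (I ×ˢ univ) ↔ a = 1 + c ^ 2)) ∧
    -- the family with a curve in the sphere and a map into the hyperbolic plane
    ((∀ x ∈ I, deriv h x ^ 2 =
        (a - h x ^ 2 + b * (1 + (h x - c) ^ 2)) * (a - h x ^ 2)) →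
      (∀ x ∈ I, 0 < h x ^ 2 - a) →
      -- this makes the map take values in the upper sheet, that is, in the hyperbolic plane
      (0 ≤ a → ∀ x ∈ I, 0 < h x) →
      ∀ φ : ℝ → R3, ContDiffOn ℝ ∞ φ I → MapsTo φ I S2 →
        (∀ x ∈ I, speedS2 φ x = √(b * (1 + (h x - c) ^ 2))) →
        (∀ x ∈ I, curvS2 o φ x = -(b * (h x ^ 2 - a)) / speedS2 φ x ^ 3) →
        IsPMC (fun p => (φ p.1, psiMap a h p)) (I ×ˢ univ) ∧
        (∀ p ∈ I ×ˢ (univ : Set ℝ),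
          metric (meanCurv (fun p => (φ p.1, psiMap a h p)) p)
            (meanCurv (fun p => (φ p.1, psiMap a h p)) p) = b / 4) ∧
        (HopfVanishes (fun p => (φ p.1, psiMap a h p)) (I ×ˢ univ) ↔ a = 1 + c ^ 2)) := by
  have hh : ∀ x ∈ I, HasDerivAt h (deriv h x) x := fun x hx =>
    ((h_smooth.differentiableOn (by simp)).differentiableAt (hI_open.mem_nhds hx)).hasDerivAt
  constructor
  · intro ha hfirst hpos ψ hψ hψm hspeed hcurv
    have hS : ∀ x ∈ I, 0 < 1 * (a - h x ^ 2) := fun x hx => by simpa using hpos x hx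
    have hγ : IsFrenetCurve (-1) b c I h (fun x => 1 * (a - h x ^ 2)) ψ
        (fun x => ((o : ℤ) : ℝ) • rot (-1) (ψ x) (deriv ψ x)) := by
      refine isFrenetCurve (by norm_num) hb hI_open hh o hψ
        (fun x hx => (lor_eq_form _ _).symm.trans (hψm hx).1) (fun x hx => ?_) (fun x hx => ?_)
      · have := hspeed x hx
        rwa [speedH2, lor_eq_form] at this
      · have := hcurv x hx
        rw [curvH2, speedH2, lor_eq_form, lor_eq_form, projH2_eq_tproj, rotH2_eq_rot] at this
        rw [this, one_mul]
    have hrot := isRotationalMap_elliptic (one_mul (1 : ℝ)) ha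
    have hphi : ∀ p : ℝ × ℝ, phiMap a h p = √(1 * (a - h p.1 ^ 2)) •
          ![(√a)⁻¹ * Real.cos (√a * p.2), (√a)⁻¹ * Real.sin (√a * p.2), 0]
        + h p.1 • ![0, 0, (√a)⁻¹] := fun p => by
      ext i
      fin_cases i <;> simp [phiMap] <;> ring
    refine isPMC_of_splitting (by norm_num) hb hI_open hI_interval h_smooth h_nonconst hS
      (fun x hx => by rw [hfirst x hx]; ring) isSplitting_inl_inr hrot hS hγ (fun p => ?_)
      fun p hp => ⟨?_, hψm hp.1⟩
    · simp [hphi]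
    · have := hrot.P_P (h p.1, p.2) (hS _ hp.1)
      rw [← hphi] at this
      exact (dot_eq_form _ _).trans this
  · intro hfirst hpos hup φ hφ hφm hspeed hcurv
    have hS : ∀ x ∈ I, 0 < -1 * (a - h x ^ 2) := fun x hx => by linarith [hpos x hx]
    have hγ : IsFrenetCurve (- -1) b c I h (fun x => -1 * (a - h x ^ 2)) φ
        (fun x => ((o : ℤ) : ℝ) • rot 1 (φ x) (deriv φ x)) := by
      rw [neg_neg]
      refine isFrenetCurve (by norm_num) hb hI_open hh o hφ
        (fun x hx => (dot_eq_form _ _).symm.trans (hφm hx)) (fun x hx => ?_) (fun x hx => ?_)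
      · have := hspeed x hx
        rwa [speedS2, dot_eq_form] at this
      · have := hcurv x hx
        rw [curvS2, speedS2, dot_eq_form, dot_eq_form, projS2_eq_tproj, rotS2_eq_rot] at this
        rw [this]
        ring
    have main : ∀ {S : Set ℝ} {P Q R : ℝ × ℝ → R3}, IsRotationalMap (-1) a S P Q R →
        (∀ x ∈ I, h x ∈ S) → (∀ p : ℝ × ℝ, psiMap a h p = P (h p.1, p.2)) →
        (∀ p : ℝ × ℝ, p.1 ∈ I → 0 < psiMap a h p 2) →
        IsPMC (fun p => (φ p.1, psiMap a h p)) (I ×ˢ univ) ∧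
        (∀ p ∈ I ×ˢ (univ : Set ℝ),
          metric (meanCurv (fun p => (φ p.1, psiMap a h p)) p)
            (meanCurv (fun p => (φ p.1, psiMap a h p)) p) = b / 4) ∧
        (HopfVanishes (fun p => (φ p.1, psiMap a h p)) (I ×ˢ univ) ↔ a = 1 + c ^ 2) := by
      intro S P Q R hrot hSP hpsi hpos2
      refine isPMC_of_splitting (by norm_num) hb hI_open hI_interval h_smooth h_nonconst hS
        (fun x hx => by rw [hfirst x hx]; ring) isSplitting_inr_inl hrot hSP hγ (fun p => ?_)
        fun p hp => ⟨hφm hp.1, ?_⟩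
      · simp [hpsi]
      · have := hrot.P_P (h p.1, p.2) (hSP _ hp.1)
        rw [← hpsi] at this
        exact mem_H2_of_form this (hpos2 p hp.1)
    rcases lt_trichotomy a 0 with ha | rfl | ha
    · refine main (isRotationalMap_hyperbolic ha) hS (fun p => ?_) (fun p hp => ?_)
      · rw [psiMap, if_neg ha.not_gt, if_pos ha]
        ext i
        fin_cases i <;> simp <;> ring
      · have h1 := Real.sqrt_pos.2 (neg_pos.2 ha)
        have h2 := Real.sqrt_pos.2 (hpos _ hp)
        have h3 := Real.cosh_pos (√(-a) * p.2)
        rw [psiMap, if_neg ha.not_gt, if_pos ha]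
        simp
        positivity
    · refine main isRotationalMap_parabolic (hup le_rfl) (fun p => ?_) (fun p hp => ?_)
      · rw [psiMap, if_neg (lt_irrefl _), if_neg (lt_irrefl _)]
        -- At zeros of `h` both sides vanish, since `0⁻¹ = 0`.
        by_cases h0 : h p.1 = 0
        · simp [h0]
        · ext i
          fin_cases i <;> simp <;> field_simp
      · have h1 := hup le_rfl _ hp
        rw [psiMap, if_neg (lt_irrefl _), if_neg (lt_irrefl _)]
        simp
        positivity
    · refine main (isRotationalMap_elliptic (by norm_num) ha) hS (fun p => ?_) (fun p hp => ?_)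
      · rw [psiMap, if_pos ha]
        ext i
        fin_cases i <;> simp <;> ring
      · have h1 := hup ha.le _ hp
        have h2 := Real.sqrt_pos.2 ha
        rw [psiMap, if_pos ha]
        simp
        positivity
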